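/- **Theorem 1 (J. Écalle).** Let $n_1,\dots,n_J\ge 1$, $n=n_1+\dots+n_J$, and let $a_1,\dots,a_J,\lambda_1,\dots,\lambda_J\in\mathbb C$ with $a_1=\lambda_1=0$, the $a_j$ not all equal, and $0\le\operatorname{Re}\lambda_j<1$ for all $j$. Put $L=\bigoplus_j(\lambda_jI_{n_j}+J_{n_j})$, where $J_{n_j}$ is the nilpotent upper Jordan block of size $n_j$, and $Q(1/x)=\bigoplus_j\frac{-a_j}{x}I_{n_j}$. Let $A(x)\in M_n(\mathbb C\{x\})$ with $A(0)\ne0$, and assume that the system $x^2Y'=A(x)Y$ has a formal fundamental solution $\widetilde Y(x)=\widetilde F(x)\,x^Le^{Q(1/x)}$ with $\widetilde F(x)=I_n+\sum_{m\ge1}F_mx^m\in GL_n(\mathbb C[[x]])$; that is, $x^2\widetilde F'+\widetilde FA_0=A\widetilde F$ with $A_0(x)=\bigoplus_j\big(a_jI_{n_j}+x(\lambda_jI_{n_j}+J_{n_j})\big)$. Let $\Omega=\{a_1,\dots,a_J\}$ and let $\widetilde f(x)=\sum_{m\ge 0}f_mx^m$ be the first $n_1$ columns of $\widetilde F(x)$.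 Then $\widetilde f$ is summable-resurgent with singular support $\Omega,0$: 1. the Borel transform $\widehat f(\xi)=\sum_{m\ge1}f_m\,\xi^{m-1}/(m-1)!$ (without the term $f_0\delta$ coming from the constant term) converges near $\xi=0$; 2. $\widehat f$ continues analytically to the Riemann surface $\mathcal R_\Omega$, whose points are the homotopy classes with fixed extremities of paths issuing from $0$ and lying in $\mathbb C\setminus\Omega$ but for their starting point $0$ (together with the constant path), with the complex structure pulled back by the projection $\pi:[\gamma]\mapsto\gamma(1)$; 3. for every $\nu>0$ smaller than half the minimal distance between the elements of $\Omega$ and every $\nu$-sectorial region $\Delta_\nu\subset\mathcal R_\Omega$ there are constants $C,K$ with $\|\widehat f(\xi)\|\le Ce^{K|\pi(\xi)|}$ for all $\xi\in\Delta_\nu$. Here a $\nu$-sectorial region is a union $D_\nu\cup\mathcal N_\nu\cup\Sigma_\nu$ of an open disc $D_\nu$ centered at $0$ on the first sheet, a tubular neighborhood $\mathcal N_\nu$ (of constant radius) of a piecewise-$\mathcal C^1$ path that starts in $D_\nu$ and ends in $\Sigma_\nu$, and an open sector $\Sigma_\nu=\{|\xi|>R,\ \alpha<\arg\xi<\beta\}$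 of bounded (possibly larger than $2\pi$) opening, such that in projection all points of $D_\nu$ are at distance greater than $\nu$ from $\Omega\setminus\{0\}$ and all points of $\mathcal N_\nu\cup\Sigma_\nu$ at distance greater than $\nu$ from $\Omega$. -/

import Mathlib

open scoped Topology unitInterval PowerSeries

noncomputable section

namespace LevelOne

/-! ### The Riemann surface of a set `Ω` of Stokes values, based at `0 ∈ Ω` -/

/-- A continuous path that issues from `0` and lies in `ℂ \ Ω` but for its starting point: it may
wait at `0`, and never meets `Ω` after having left `0`. In particular, when `0 ∈ Ω`, the only such
path ending at `0` is the constant one. -/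
def Admissible (Ω : Set ℂ) (γ : C(I, ℂ)) : Prop :=
  γ 0 = 0 ∧ ∀ t, γ t ∈ Ω → ∀ s ≤ t, γ s = 0

/-- The admissible paths, with their end-points. -/
structure AdmPath (Ω : Set ℂ) where
  endpt : ℂ
  path : Path (0 : ℂ) endpt
  adm : Admissible Ω path.toContinuousMap

/-- Homotopy with fixed extremities through admissible paths. -/
def AdmPath.Homotopic {Ω : Set ℂ} (γ₀ γ₁ : AdmPath Ω) : Prop :=
  ContinuousMap.HomotopicWith γ₀.path.toContinuousMap γ₁.path.toContinuousMap
    (fun γ => Admissible Ω γ ∧ γ 1 = γ₀.endpt)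

theorem AdmPath.Homotopic.endpt_eq {Ω : Set ℂ} {γ₀ γ₁ : AdmPath Ω} (h : γ₀.Homotopic γ₁) :
    γ₁.endpt = γ₀.endpt := by
  obtain ⟨H⟩ := h
  have h1 := (H.prop 1).2
  have h2 : H.toHomotopy.curry 1 1 = γ₁.path.toContinuousMap 1 := H.toHomotopy.apply_one 1
  rw [h2] at h1
  simpa using h1

instance admSetoid (Ω : Set ℂ) : Setoid (AdmPath Ω) where
  r := AdmPath.Homotopic
  iseqv := by
    refine ⟨fun γ => ?_, fun {γ₀ γ₁} h => ?_, fun {γ₀ γ₁ γ₂} h h' => ?_⟩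
    · exact ContinuousMap.HomotopicWith.refl _ ⟨γ.adm, by simp⟩
    · have e := h.endpt_eq
      unfold AdmPath.Homotopic at h ⊢
      simp only [e]
      exact h.symm
    · have e := h.endpt_eq
      unfold AdmPath.Homotopic at h h' ⊢
      simp only [e] at h'
      exact h.trans h'

/-- The points of the surface are the homotopy classes of admissible paths. -/
def RSurface (Ω : Set ℂ) : Type := Quotient (admSetoid Ω)

namespace RSurface

/-- The class of an admissible path. -/
def mk {Ω : Set ℂ} {z : ℂ} (γ : Path (0 : ℂ) z) (h : Admissible Ω γ.toContinuousMap) :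
    RSurface Ω :=
  Quotient.mk (admSetoid Ω) ⟨z, γ, h⟩

/-- The natural projection, which sends the class of a path to the end-point of the path. -/
def proj {Ω : Set ℂ} : RSurface Ω → ℂ :=
  Quotient.lift AdmPath.endpt fun _ _ h => (AdmPath.Homotopic.endpt_eq h).symm

/-- The class of the constant path. -/
def origin (Ω : Set ℂ) : RSurface Ω :=
  mk (Path.refl 0) ⟨rfl, fun _ _ _ _ => rfl⟩

/-- The classes of the admissible paths made of `γ` followed by a path that stays in the disc of
radius `r` centered at the end-point of `γ`. -/
def nbhd {Ω : Set ℂ} (γ : AdmPath Ω) (r : ℝ) : Set (RSurface Ω) :=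
  {q | ∃ (z : ℂ) (η : Path γ.endpt z) (h : Admissible Ω (γ.path.trans η).toContinuousMap),
    (∀ t, η t ∈ Metric.ball γ.endpt r) ∧ q = mk (γ.path.trans η) h}

/-- The usual topology on a space of homotopy classes of paths; it makes the projection a local
homeomorphism. -/
instance (Ω : Set ℂ) : TopologicalSpace (RSurface Ω) :=
  TopologicalSpace.generateFrom {U | ∃ (γ : AdmPath Ω) (r : ℝ), 0 < r ∧ U = nbhd γ r}

/-- Analyticity for the complex structure pulled back by the projection: near every point, the
function is an analytic function of the projection. -/
def IsAnalytic {Ω : Set ℂ} (Φ : RSurface Ω → ℂ) : Prop :=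
  ∀ p, ∃ g : ℂ → ℂ, AnalyticAt ℂ g (proj p) ∧ ∀ᶠ q in 𝓝 p, Φ q = g (proj q)

end RSurface

/-! ### Sectorial regions -/

/-- A path is piecewise `C¹` when it is `C¹` on each closed interval of a finite subdivision. -/
def IsPiecewiseC1 {z w : ℂ} (γ : Path z w) : Prop :=
  ∃ (N : ℕ) (τ : ℕ → ℝ), Monotone τ ∧ τ 0 = 0 ∧ τ N = 1 ∧
    ∀ i < N, ContDiffOn ℝ 1 γ.extend (Set.Icc (τ i) (τ (i + 1)))

/-- The point with polar coordinates `(ρ, θ)`. -/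
def polar (x : ℝ × ℝ) : ℂ := (x.1 : ℂ) * Complex.exp ((x.2 : ℂ) * Complex.I)

theorem continuous_polar : Continuous polar := by
  unfold polar
  fun_prop

/-- A `ν`-sectorial region of the surface of `Ω`. It is composed of a disc `D` centered at `0` on
the first sheet, a tubular neighborhood `N` of a piecewise `C¹` path `γ` that starts in `D`, and an
open sector `S` at infinity, of bounded opening, where `γ` ends. The opening may exceed `2π`, so
that sectors are given in polar coordinates. -/
structure SectorialRegion (Ω : Set ℂ) (ν : ℝ) where
  ν_pos : 0 < ν
  ν_lt : ∀ a ∈ Ω, ∀ b ∈ Ω, a ≠ b → ν < dist a b / 2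
  /-- the radius of `D` -/
  d : ℝ
  d_pos : 0 < d
  D_dist : ∀ z ∈ Metric.ball (0 : ℂ) d, ∀ a ∈ Ω \ {0}, ν < dist z a
  /-- the sector `S` is `ρ > R`, `α < θ < β` -/
  R : ℝ
  R_nonneg : 0 ≤ R
  α : ℝ
  β : ℝ
  S_dist : ∀ x ∈ Set.Ioi R ×ˢ Set.Ioo α β, ∀ a ∈ Ω, ν < dist (polar x) a
  /-- the starting point of `γ` -/
  p : ℂ
  p_mem : p ∈ Metric.ball (0 : ℂ) d
  /-- polar coordinates of the end-point of `γ` -/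
  e : ℝ × ℝ
  e_mem : e ∈ Set.Ioi R ×ˢ Set.Ioo α β
  γ : Path p (polar e)
  γ_C1 : IsPiecewiseC1 γ
  /-- the radius of the tube `N` -/
  w : ℝ
  w_pos : 0 < w
  N_dist : ∀ t, ∀ z ∈ Metric.ball (γ t) w, ∀ a ∈ Ω, ν < dist z a

namespace SectorialRegion

variable {Ω : Set ℂ} {ν : ℝ}

/-- The disc `D` on the first sheet. -/
def discPart (Δ : SectorialRegion Ω ν) : Set (RSurface Ω) :=
  {q | ∃ z ∈ Metric.ball (0 : ℂ) Δ.d, ∃ h : Admissible Ω (Path.segment 0 z).toContinuousMap,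
    q = RSurface.mk (Path.segment 0 z) h}

/-- The tube `N`: go straight from `0` to the starting point of `γ`, follow `γ` up to some time
`t`, then go straight to a point at distance less than `w` from `γ t`. -/
def tubePart (Δ : SectorialRegion Ω ν) : Set (RSurface Ω) :=
  {q | ∃ t : I, ∃ z ∈ Metric.ball (Δ.γ t) Δ.w,
    ∃ h : Admissible Ω ((((Path.segment 0 (Δ.γ 0)).trans (Δ.γ.subpath 0 t)).trans
      (Path.segment (Δ.γ t) z)).toContinuousMap),
    q = RSurface.mk (((Path.segment 0 (Δ.γ 0)).trans (Δ.γ.subpath 0 t)).trans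
      (Path.segment (Δ.γ t) z)) h}

/-- The sector `S`: go straight from `0` to the starting point of `γ`, follow `γ`, then move inside
the sector along a segment in polar coordinates. -/
def sectorPart (Δ : SectorialRegion Ω ν) : Set (RSurface Ω) :=
  {q | ∃ x ∈ Set.Ioi Δ.R ×ˢ Set.Ioo Δ.α Δ.β,
    ∃ h : Admissible Ω ((((Path.segment 0 Δ.p).trans Δ.γ).trans
      ((Path.segment Δ.e x).map continuous_polar)).toContinuousMap),
    q = RSurface.mk (((Path.segment 0 Δ.p).trans Δ.γ).trans
      ((Path.segment Δ.e x).map continuous_polar)) h}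

/-- The region itself. -/
def carrier (Δ : SectorialRegion Ω ν) : Set (RSurface Ω) :=
  Δ.discPart ∪ Δ.tubePart ∪ Δ.sectorPart

end SectorialRegion

/-! ### Summable-resurgence -/

/-- Convergence of a power series near `0`. -/
def IsConvergent (f : ℂ⟦X⟧) : Prop :=
  ∃ r : ℝ, 0 < r ∧ Summable fun m => ‖PowerSeries.coeff m f‖ * r ^ m

/-- The formal Borel transform `∑_{m ≥ 1} f_m ξ^(m-1) / (m-1)!` of `∑ f_m x^m`. The constant term,
the Borel transform of which is a multiple of the Dirac mass at `0`, is left out. -/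
def borelTransform (f : ℂ⟦X⟧) : ℂ⟦X⟧ :=
  PowerSeries.mk fun m => PowerSeries.coeff (m + 1) f / (m.factorial : ℂ)

/-- A summable-resurgent function with singular support `Ω, 0`: an analytic function on the surface
of `Ω` with at most exponential growth on every sectorial region. -/
def IsSummableResurgentFunction {Ω : Set ℂ} (Φ : RSurface Ω → ℂ) : Prop :=
  RSurface.IsAnalytic Φ ∧
    ∀ (ν : ℝ) (Δ : SectorialRegion Ω ν), ∃ C K : ℝ, ∀ q ∈ Δ.carrier,
      ‖Φ q‖ ≤ C * Real.exp (K * ‖RSurface.proj q‖)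

/-- A summable-resurgent series with singular support `Ω, 0`: its Borel transform converges near
`0` and continues analytically to a summable-resurgent function. -/
def IsSummableResurgent (Ω : Set ℂ) (f : ℂ⟦X⟧) : Prop :=
  IsConvergent (borelTransform f) ∧
    ∃ Φ : RSurface Ω → ℂ, IsSummableResurgentFunction Φ ∧
      ∀ᶠ q in 𝓝 (RSurface.origin Ω),
        HasSum (fun m => PowerSeries.coeff m (borelTransform f) * RSurface.proj q ^ m) (Φ q)

/-! ### Level-one systems -/

/-- The nilpotent Jordan block of size `m`. -/
def jordan (m : ℕ) : Matrix (Fin m) (Fin m) ℂ⟦X⟧ :=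
  Matrix.of fun i k => if (i : ℕ) + 1 = (k : ℕ) then 1 else 0

/-- The matrix `A₀(x) = ⨁ⱼ (aⱼ I + x (λⱼ I + Jⱼ))` of the normal form `x² Y' = A₀(x) Y`, of which
`x^L e^{Q(1/x)}`, with `L = ⨁ⱼ (λⱼ I + Jⱼ)` and `Q(1/x) = ⨁ⱼ (-aⱼ/x) I`, is a fundamental
solution. -/
def normalForm {J : ℕ} (n : Fin J → ℕ) (a lam : Fin J → ℂ) :
    Matrix (Σ j, Fin (n j)) (Σ j, Fin (n j)) ℂ⟦X⟧ :=
  Matrix.blockDiagonal' fun j =>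
    PowerSeries.C (a j) • (1 : Matrix (Fin (n j)) (Fin (n j)) ℂ⟦X⟧) +
      (PowerSeries.X : ℂ⟦X⟧) • (PowerSeries.C (lam j) • 1 + jordan (n j))

/-- `F(x) x^L e^{Q(1/x)}` is a formal solution of `x² Y' = A(x) Y`. As `x^L e^{Q(1/x)}` is
invertible and solves `x² Y' = A₀(x) Y`, this reads `x² F' + F A₀ = A F`. -/
def IsFormalSolution {J : ℕ} (n : Fin J → ℕ) (a lam : Fin J → ℂ)
    (A F : Matrix (Σ j, Fin (n j)) (Σ j, Fin (n j)) ℂ⟦X⟧) : Prop :=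
  (PowerSeries.X : ℂ⟦X⟧) ^ 2 • F.map (PowerSeries.derivative ℂ) + F * normalForm n a lam = A * F

/-- The system `x² Y' = A(x) Y`, with the formal fundamental solution `F(x) x^L e^{Q(1/x)}`, has
rank one, a single level equal to one, and is in prepared form. The blocks are numbered from `0`. -/
structure IsPrepared {J : ℕ} [NeZero J] (n : Fin J → ℕ) (a lam : Fin J → ℂ)
    (A F : Matrix (Σ j, Fin (n j)) (Σ j, Fin (n j)) ℂ⟦X⟧) : Prop where
  size_pos : ∀ j, 0 < n j
  convergent : ∀ i k, IsConvergent (A i k)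
  rank_one : A.map PowerSeries.constantCoeff ≠ 0
  level_one : ∃ j k, a j ≠ a k
  formal_solution : IsFormalSolution n a lam A F
  F_zero : F.map PowerSeries.constantCoeff = 1
  re_lam : ∀ j, 0 ≤ (lam j).re ∧ (lam j).re < 1
  a_zero : a 0 = 0
  lam_zero : lam 0 = 0

end LevelOne

end

noncomputable section

namespace LevelOne

/-! ### Power series with geometrically bounded coefficients -/

section PowerSeriesODE

variable {F : Type*} [NormedAddCommGroup F] [NormedSpace ℂ F]

/-! The Borel transform turns `x² d/dx` into multiplication by `ξ` and multiplication by `x` into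
integration from `0`, so the system becomes a convolution equation. It becomes an ordinary linear
differential equation once all iterated primitives are adjoined as unknowns.

Stack the first block of columns into one vector `y`. It satisfies `x² y' = B(x) y` with `B = ∑ b_l
x^l` convergent and `B(0)` diagonal with entries in `Ω`. Let `w_l` be the Borel transform of `κ^l
x^l y`. Then `w_{l+1}' = κ w_l`, and differentiating the transformed system once gives `(ξ - a_i)
w_{0,i}' = ∑_{l,j} b_{l+1,i,j} κ^{-l} w_{l,j} - w_{0,i}`. If `|b_l| ≤ M s^l` and `κ = 2s`, the
right-hand side is a bounded linear form on bounded families. Hence `w' = c(ξ) w` in a Banach space,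
where `c` is a constant operator plus simple poles at the `a_i`: it is analytic off `Ω` and bounded
at distance greater than `ν` from `Ω`.

The recurrence for the coefficients gives Gevrey bounds, which make `w` analytic at `0` with values
in the Banach space (`exists_norm_succ_le`, `exists_gevrey_bound`, `norm_borelCoeffFun_le`). By
linearity, solutions exist on discs that do not depend on the initial value, so the germ continues
along every admissible path (`exists_transports`). By uniqueness, the space of germs is a separated
local homeomorphism over `ℂ`, and the monodromy theorem shows that only the homotopy class matters
(`Transports.eq_of_homotopic`).

Grönwall's inequality bounds the continuation by the exponential of a multiple of the path length,
and the points of a sectorial region are reached by paths whose length is at most affine in `|π(ξ)|`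
(`exists_growth_bound`). Everything is put together in `isSummableResurgent_of_recurrence`. -/

theorem summable_norm_pow_smul {e : ℕ → F} {C K : ℝ} (hK : 0 < K)
    (he : ∀ k, ‖e k‖ ≤ C * K ^ k) {z : ℂ} (hz : ‖z‖ * K < 1) :
    Summable fun k => ‖z ^ k • e k‖ := by
  refine Summable.of_nonneg_of_le (fun _ => norm_nonneg _) (fun k => ?_)
    ((summable_geometric_of_lt_one (by positivity) hz).mul_left C)
  rw [norm_smul, norm_pow, mul_pow]
  calc ‖z‖ ^ k * ‖e k‖ ≤ ‖z‖ ^ k * (C * K ^ k) := by gcongr; exact he k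
    _ = _ := by ring

variable [CompleteSpace F]

theorem summable_pow_smul_succ {e : ℕ → F} {C K : ℝ} (hK : 0 < K)
    (he : ∀ k, ‖e k‖ ≤ C * K ^ k) {z : ℂ} (hz : ‖z‖ * K < 1) :
    Summable fun k : ℕ => z ^ k • ((k + 1 : ℂ) • e (k + 1)) := by
  have h1 := summable_pow_mul_geometric_of_norm_lt_one (R := ℝ) 1 (r := ‖z‖ * K)
    (by rwa [Real.norm_of_nonneg (by positivity)])
  have h0 := summable_geometric_of_lt_one (r := ‖z‖ * K) (by positivity) hz
  refine Summable.of_norm_bounded ((h1.add h0).mul_left (C * K)) fun k => ?_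
  have hk : ‖(k + 1 : ℂ)‖ = k + 1 := by exact_mod_cast Complex.norm_natCast (k + 1)
  rw [norm_smul, norm_smul, norm_pow, hk]
  calc ‖z‖ ^ k * ((k + 1) * ‖e (k + 1)‖) ≤ ‖z‖ ^ k * ((k + 1) * (C * K ^ (k + 1))) := by
        gcongr; exact he _
    _ = _ := by ring

theorem hasDerivAt_tsum_pow_smul {e : ℕ → F} {C K : ℝ} (hK : 0 < K)
    (he : ∀ k, ‖e k‖ ≤ C * K ^ k) {z : ℂ} (hz : ‖z‖ * K < 1) :
    HasDerivAt (fun z : ℂ => ∑' k, z ^ k • e k)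
      (∑' k : ℕ, z ^ k • ((k + 1 : ℂ) • e (k + 1))) z := by
  obtain ⟨ρ, hρ, hρ1⟩ : ∃ ρ, ‖z‖ < ρ ∧ ρ * K < 1 := by
    obtain ⟨ρ, h1, h2⟩ := exists_between ((lt_div_iff₀ hK).2 hz)
    exact ⟨ρ, h1, (lt_div_iff₀ hK).1 h2⟩
  have hρ0 : 0 < ρ := (norm_nonneg z).trans_lt hρ
  have hu : Summable fun k : ℕ => C * K * ((k : ℝ) * (ρ * K) ^ (k - 1)) := by
    refine Summable.mul_left _ ?_
    rw [← summable_nat_add_iff 1]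
    have h1 := summable_pow_mul_geometric_of_norm_lt_one (R := ℝ) 1 (r := ρ * K)
      (by rwa [Real.norm_of_nonneg (by positivity)])
    have h0 := summable_geometric_of_lt_one (r := ρ * K) (by positivity) hρ1
    refine (h1.add h0).congr fun k => ?_
    rw [Nat.add_sub_cancel]
    push_cast
    ring
  have key := hasDerivAt_tsum_of_isPreconnected (𝕜 := ℂ) (F := F)
    (g := fun k z => z ^ k • e k) (g' := fun k z => ((k : ℂ) * z ^ (k - 1)) • e k)
    (t := Metric.ball 0 ρ) (y₀ := 0) (y := z) hu Metric.isOpen_ball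
    (convex_ball _ _).isPreconnected
    (fun k y _ => (hasDerivAt_pow k y).smul_const (e k))
    (fun k y hy => ?_) (Metric.mem_ball_self hρ0)
    (summable_norm_pow_smul hK he (by simp)).of_norm (by simpa using hρ)
  · convert key using 1
    have hs : Summable fun k : ℕ => ((k : ℂ) * z ^ (k - 1)) • e k := by
      refine (summable_nat_add_iff 1).1 ((summable_pow_smul_succ hK he hz).congr fun k => ?_)
      rw [smul_smul, Nat.add_sub_cancel, mul_comm]
      push_cast
      rfl
    rw [hs.tsum_eq_zero_add]
    simp only [Nat.cast_zero, zero_mul, zero_smul, zero_add, Nat.add_sub_cancel]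
    refine tsum_congr fun k => ?_
    rw [smul_smul]
    push_cast
    congr 1
    ring
  · have hy' : ‖y‖ ≤ ρ := by simpa using (Metric.mem_ball.1 hy).le
    rw [norm_smul, norm_mul, norm_pow, Complex.norm_natCast]
    rcases k with _ | k
    · simp
    · simp only [Nat.add_sub_cancel]
      calc ((k + 1 : ℕ) : ℝ) * ‖y‖ ^ k * ‖e (k + 1)‖
          ≤ ((k + 1 : ℕ) : ℝ) * ρ ^ k * (C * K ^ (k + 1)) := by
            gcongr; exact he _
        _ = _ := by ring

theorem analyticAt_tsum_pow_smul {e : ℕ → F} {C K : ℝ} (hK : 0 < K)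
    (he : ∀ k, ‖e k‖ ≤ C * K ^ k) {z : ℂ} (hz : ‖z‖ * K < 1) :
    AnalyticAt ℂ (fun z : ℂ => ∑' k, z ^ k • e k) z := by
  have ho : IsOpen {z : ℂ | ‖z‖ * K < 1} := isOpen_lt (by fun_prop) continuous_const
  refine DifferentiableOn.analyticAt (s := {z : ℂ | ‖z‖ * K < 1}) (fun y hy => ?_)
    (ho.mem_nhds hz)
  exact (hasDerivAt_tsum_pow_smul hK he hy).differentiableAt.differentiableWithinAt

/-- The coefficients of the solution `U`, with `U(0) = 1`, of `U' = (∑ c_k z^k) U`. -/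
def fundamentalCoeff {𝔸 : Type*} [NormedRing 𝔸] [NormedAlgebra ℂ 𝔸] (c : ℕ → 𝔸) : ℕ → 𝔸
  | 0 => 1
  | k + 1 => (k + 1 : ℂ)⁻¹ • ∑ j : Fin (k + 1), c (k - j) * fundamentalCoeff c j
  decreasing_by exact j.2

variable {𝔸 : Type*} [NormedRing 𝔸] [NormedAlgebra ℂ 𝔸]

theorem fundamentalCoeff_succ (c : ℕ → 𝔸) (k : ℕ) :
    (k + 1 : ℂ) • fundamentalCoeff c (k + 1) =
      ∑ j ∈ Finset.range (k + 1), c (k - j) * fundamentalCoeff c j := by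
  rw [fundamentalCoeff, smul_smul, mul_inv_cancel₀ (by exact_mod_cast k.succ_ne_zero), one_smul,
    Finset.sum_range]

/-- Induction on `k`. Since `ρ ≤ K / 2`, the convolution is dominated by `M K^k` times a geometric
sum of ratio `1/2`, hence at most `2`; the factor `2 M` is then absorbed by `K`. The division by `k
+ 1` is not exploited. -/
theorem norm_fundamentalCoeff_le {c : ℕ → 𝔸} {M ρ K : ℝ} (hρ : 0 < ρ)
    (hc : ∀ k, ‖c k‖ ≤ M * ρ ^ k) (hK : 2 * ρ ≤ K) (hK' : 2 * M ≤ K) (k : ℕ) :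
    ‖fundamentalCoeff c k‖ ≤ ‖(1 : 𝔸)‖ * K ^ k := by
  have hK0 : 0 < K := by linarith
  have hM : 0 ≤ M := by simpa using (norm_nonneg _).trans (hc 0)
  induction k using Nat.strong_induction_on with
  | _ k ih =>
    rcases k with _ | k
    · simp [fundamentalCoeff]
    have hk : (0 : ℝ) < k + 1 := by positivity
    have h1 : ‖(k + 1 : ℂ) • fundamentalCoeff c (k + 1)‖ =
        (k + 1) * ‖fundamentalCoeff c (k + 1)‖ := by
      rw [norm_smul]
      congr 1
      exact_mod_cast Complex.norm_natCast (k + 1)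
    have h2 : ‖∑ j ∈ Finset.range (k + 1), c (k - j) * fundamentalCoeff c j‖ ≤
        M * ‖(1 : 𝔸)‖ * K ^ k * 2 := by
      calc ‖∑ j ∈ Finset.range (k + 1), c (k - j) * fundamentalCoeff c j‖
          ≤ ∑ j ∈ Finset.range (k + 1), M * ‖(1 : 𝔸)‖ * K ^ k * (1 / 2) ^ (k - j) := by
            refine norm_sum_le_of_le _ fun j hj => ?_
            have hj' : j ≤ k := Nat.lt_succ_iff.1 (Finset.mem_range.1 hj)
            calc ‖c (k - j) * fundamentalCoeff c j‖
                ≤ ‖c (k - j)‖ * ‖fundamentalCoeff c j‖ := norm_mul_le _ _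
              _ ≤ (M * ρ ^ (k - j)) * (‖(1 : 𝔸)‖ * K ^ j) := by
                  gcongr
                  · exact hc _
                  · exact ih j (Nat.lt_succ_of_le hj')
              _ ≤ (M * (K / 2) ^ (k - j)) * (‖(1 : 𝔸)‖ * K ^ j) := by
                  gcongr; linarith
              _ = M * ‖(1 : 𝔸)‖ * (K ^ (k - j) * K ^ j) * (1 / 2) ^ (k - j) := by
                  rw [div_eq_mul_one_div, mul_pow]; ring
              _ = _ := by rw [← pow_add, Nat.sub_add_cancel hj']
        _ = M * ‖(1 : 𝔸)‖ * K ^ k * ∑ j ∈ Finset.range (k + 1), (1 / 2 : ℝ) ^ j := by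
            rw [← Finset.mul_sum, ← Finset.sum_range_reflect (fun j => (1 / 2 : ℝ) ^ j)]
            rfl
        _ ≤ _ := by
            gcongr
            have := Summable.sum_le_tsum (Finset.range (k + 1)) (fun _ _ => by positivity)
              summable_geometric_two
            rwa [tsum_geometric_two] at this
    rw [← fundamentalCoeff_succ, h1] at h2
    calc ‖fundamentalCoeff c (k + 1)‖ ≤ (k + 1) * ‖fundamentalCoeff c (k + 1)‖ := by
          refine le_mul_of_one_le_left (norm_nonneg _) ?_
          linarith [(Nat.cast_nonneg k : (0 : ℝ) ≤ k)]
      _ ≤ M * ‖(1 : 𝔸)‖ * K ^ k * 2 := h2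
      _ = ‖(1 : 𝔸)‖ * K ^ k * (2 * M) := by ring
      _ ≤ ‖(1 : 𝔸)‖ * K ^ k * K := by gcongr
      _ = _ := by ring

variable [CompleteSpace 𝔸]

/-- A linear differential equation with analytic coefficient has a fundamental solution. -/
theorem exists_fundamental_solution {c : ℂ → 𝔸} {z₀ : ℂ} (hc : AnalyticAt ℂ c z₀) :
    ∃ U : ℂ → 𝔸, U z₀ = 1 ∧ ∀ᶠ z in 𝓝 z₀, HasDerivAt U (c z * U z) z := by
  obtain ⟨p, hp⟩ := hc
  obtain ⟨r, hr0, hr⟩ := ENNReal.lt_iff_exists_nnreal_btwn.1 hp.radius_pos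
  have hr0' : (0 : ℝ) < r := by exact_mod_cast hr0
  obtain ⟨M, hM, hMp⟩ := p.norm_le_div_pow_of_pos_of_lt_radius hr0' hr
  set b : ℕ → 𝔸 := fun k => p.coeff k
  have hb : ∀ k, ‖b k‖ ≤ M * (r : ℝ)⁻¹ ^ k := fun k => by
    rw [← p.norm_apply_eq_norm_coef, inv_pow, ← div_eq_mul_inv]; exact hMp k
  set K : ℝ := max (2 * (r : ℝ)⁻¹) (2 * M) with hKdef
  have hK0 : 0 < K := lt_max_of_lt_right (by linarith)
  have hu := norm_fundamentalCoeff_le (inv_pos.2 hr0') hb (le_max_left _ _) (le_max_right _ _)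
  set u := fundamentalCoeff b
  refine ⟨fun z => ∑' k, (z - z₀) ^ k • u k, ?_, ?_⟩
  · simp only [sub_self]
    rw [tsum_eq_single 0 (fun k hk => by simp [hk])]
    simp [u, fundamentalCoeff]
  have h1 : ∀ᶠ z in 𝓝 z₀, HasSum (fun k => (z - z₀) ^ k • b k) (c z) := by
    have h := hasFPowerSeriesAt_iff'.1 hp
    exact h
  have h2 : ∀ᶠ z in 𝓝 z₀, ‖z - z₀‖ * K < 1 :=
    ContinuousAt.eventually_lt (by fun_prop) (by fun_prop) (by simp)
  filter_upwards [h1, h2] with z hz1 hz2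
  have hd := (hasDerivAt_tsum_pow_smul hK0 hu hz2).comp_sub_const z z₀
  have hbK : ∀ k, ‖b k‖ ≤ M * K ^ k := fun k => (hb k).trans (by
    gcongr
    refine le_trans ?_ (le_max_left _ _)
    linarith [inv_pos.2 hr0'])
  have hsb := summable_norm_pow_smul hK0 hbK hz2
  have hsu := summable_norm_pow_smul hK0 hu hz2
  suffices h : c z * ∑' k, (z - z₀) ^ k • u k =
      ∑' k : ℕ, (z - z₀) ^ k • ((k + 1 : ℂ) • u (k + 1)) by
    rw [h]; exact hd
  -- The Cauchy product of the two series is compared coefficientwise with the derivative, which is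
  -- exactly the recurrence defining `u`.
  rw [← hz1.tsum_eq, tsum_mul_tsum_eq_tsum_sum_range_of_summable_norm hsb hsu]
  refine tsum_congr fun k => ?_
  rw [fundamentalCoeff_succ, Finset.smul_sum,
    ← Finset.sum_range_reflect]
  refine Finset.sum_congr rfl fun j hj => ?_
  have hj' : j ≤ k := Nat.lt_succ_iff.1 (Finset.mem_range.1 hj)
  have e1 : k + 1 - 1 - j = k - j := by omega
  have e2 : k - (k - j) = j := by omega
  rw [e1, e2, smul_mul_smul_comm, ← pow_add, Nat.sub_add_cancel hj']

end PowerSeriesODE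

/-! ### Linear differential equations with singular set `Ω` and their étale space of solutions -/

/-- A linear differential equation `W' = c(z) W` in a Banach space, analytic outside of a closed set
`Ω ∋ 0`, with a distinguished solution which is analytic at the singular point `0`. -/
structure SingularConnection (Ω : Set ℂ) (E : Type*) [NormedAddCommGroup E]
    [NormedSpace ℂ E] where
  zero_mem : (0 : ℂ) ∈ Ω
  isClosed : IsClosed Ω
  coef : ℂ → E →L[ℂ] E
  coef_analyticAt : ∀ z ∉ Ω, AnalyticAt ℂ coef z
  germ : ℂ → E
  radius : ℝ
  radius_pos : 0 < radius
  eq_zero_of_mem : ∀ z ∈ Metric.ball (0 : ℂ) radius, z ∈ Ω → z = 0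
  germ_analyticAt : ∀ z ∈ Metric.ball (0 : ℂ) radius, AnalyticAt ℂ germ z
  germ_hasDerivAt : ∀ z ∈ Metric.ball (0 : ℂ) radius, z ≠ 0 → HasDerivAt germ (coef z (germ z)) z

namespace SingularConnection

variable {Ω : Set ℂ} {E : Type*} [NormedAddCommGroup E] [NormedSpace ℂ E]
  (S : SingularConnection Ω E)

/-- The local solutions: those on a domain that avoids `Ω`, and the restrictions of the germ. -/
def IsLeaf (U : Set ℂ) (W : ℂ → E) : Prop :=
  (Disjoint U Ω ∧ ∀ z ∈ U, HasDerivAt W (S.coef z (W z)) z) ∨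
    (U ⊆ Metric.ball 0 S.radius ∧ W = S.germ)

theorem isLeaf_germ : S.IsLeaf (Metric.ball 0 S.radius) S.germ :=
  Or.inr ⟨subset_rfl, rfl⟩

variable {S}

namespace IsLeaf

variable {U V : Set ℂ} {W W₁ W₂ : ℂ → E}

theorem mono (h : S.IsLeaf U W) (hV : V ⊆ U) : S.IsLeaf V W :=
  h.imp (fun h => ⟨h.1.mono_left hV, fun z hz => h.2 z (hV hz)⟩)
    (fun h => ⟨hV.trans h.1, h.2⟩)

theorem hasDerivAt (h : S.IsLeaf U W) {z : ℂ} (hz : z ∈ U) (hzΩ : z ∉ Ω) :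
    HasDerivAt W (S.coef z (W z)) z := by
  rcases h with h | ⟨h, rfl⟩
  · exact h.2 z hz
  · exact S.germ_hasDerivAt z (h hz) fun h0 => hzΩ (h0 ▸ S.zero_mem)

theorem analyticAt [CompleteSpace E] (h : S.IsLeaf U W) (hU : IsOpen U) {z : ℂ} (hz : z ∈ U) :
    AnalyticAt ℂ W z := by
  rcases h with h | ⟨h, rfl⟩
  · exact DifferentiableOn.analyticAt
      (fun y hy => (h.2 y hy).differentiableAt.differentiableWithinAt) (hU.mem_nhds hz)
  · exact S.germ_analyticAt z (h hz)

theorem eq_base_of_mem (h : S.IsLeaf U W) {z : ℂ} (hz : z ∈ U) (hzΩ : z ∈ Ω) :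
    (z, W z) = (0, S.germ 0) := by
  rcases h with h | ⟨h, rfl⟩
  · exact absurd hzΩ (Set.disjoint_left.1 h.1 hz)
  · rw [S.eq_zero_of_mem z (h hz) hzΩ]

/-- If `U` meets `Ω`, both leaves are the distinguished germ. Otherwise the difference solves the
linear equation along each segment from `z₀` and vanishes at its start, hence vanishes by a Grönwall
argument. This uniqueness makes the topology of the étale space well defined and its projection
separated. -/
theorem eqOn (h₁ : S.IsLeaf U W₁) (h₂ : S.IsLeaf U W₂) (hU : Convex ℝ U) {z₀ : ℂ} (hz₀ : z₀ ∈ U)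
    (h0 : W₁ z₀ = W₂ z₀) : Set.EqOn W₁ W₂ U := by
  by_cases hd : Disjoint U Ω
  swap
  · rcases h₁ with h₁ | h₁
    · exact absurd h₁.1 hd
    rcases h₂ with h₂ | h₂
    · exact absurd h₂.1 hd
    rw [h₁.2, h₂.2]
    exact fun _ _ => rfl
  intro z hz
  set δ : ℝ → ℂ := fun t => AffineMap.lineMap z₀ z t with hδ
  have hδU : ∀ t ∈ Set.Icc (0 : ℝ) 1, δ t ∈ U := fun t ht => by
    have := hU.segment_subset hz₀ hz
    rw [segment_eq_image_lineMap] at this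
    exact this ⟨t, ht, rfl⟩
  have hδ' : ∀ t, HasDerivAt δ (z - z₀) t := fun t => by
    simpa using AffineMap.hasDerivAt_lineMap (a := z₀) (b := z) (x := t)
  have hδc : Continuous δ := AffineMap.lineMap_continuous
  have hcont : ContinuousOn (fun t => ‖S.coef (δ t)‖) (Set.Icc 0 1) := fun t ht =>
    ((S.coef_analyticAt _ (Set.disjoint_left.1 hd (hδU t ht))).continuousAt.norm.comp
      hδc.continuousAt).continuousWithinAt
  obtain ⟨K, hK⟩ := isCompact_Icc.bddAbove_image hcont
  have hK' : ∀ t ∈ Set.Icc (0 : ℝ) 1, ‖S.coef (δ t)‖ ≤ K := fun t ht =>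
    hK (Set.mem_image_of_mem _ ht)
  have hder : ∀ t ∈ Set.Icc (0 : ℝ) 1, HasDerivAt (fun t => W₁ (δ t) - W₂ (δ t))
      ((z - z₀) • S.coef (δ t) (W₁ (δ t) - W₂ (δ t))) t := fun t ht => by
    have hn := Set.disjoint_left.1 hd (hδU t ht)
    have e1 := (h₁.hasDerivAt (hδU t ht) hn).scomp t (hδ' t)
    have e2 := (h₂.hasDerivAt (hδU t ht) hn).scomp t (hδ' t)
    have := e1.sub e2
    rw [← smul_sub, ← map_sub] at this
    exact this
  have key := eq_zero_of_abs_deriv_le_mul_abs_self_of_eq_zero_right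
    (f := fun t => W₁ (δ t) - W₂ (δ t)) (K := ‖z - z₀‖ * K) (a := 0) (b := 1)
    (fun t ht => (hder t ht).continuousAt.continuousWithinAt)
    (fun t ht => (hder t (Set.Ico_subset_Icc_self ht)).hasDerivWithinAt)
    (by simp [hδ, h0])
    (fun t ht => by
      rw [norm_smul, mul_assoc]
      gcongr
      exact ((S.coef (δ t)).le_opNorm _).trans
        (by gcongr; exact hK' t (Set.Ico_subset_Icc_self ht))) 1 (by simp)
  simpa [hδ, sub_eq_zero] using key

end IsLeaf

theorem exists_germ_bound (S : SingularConnection Ω E) :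
    ∃ C, ∀ z ∈ Metric.closedBall (0 : ℂ) (S.radius / 2), ‖S.germ z‖ ≤ C := by
  have hc : ContinuousOn (fun z => ‖S.germ z‖) (Metric.closedBall 0 (S.radius / 2)) := fun z hz =>
    (S.germ_analyticAt z (Metric.closedBall_subset_ball (half_lt_self S.radius_pos)
      hz)).continuousAt.norm.continuousWithinAt
  obtain ⟨C, hC⟩ := (isCompact_closedBall _ _).bddAbove_image hc
  exact ⟨C, fun z hz => hC (Set.mem_image_of_mem _ hz)⟩

/-- The fundamental solution `U` is invertible near `z`, and `U(y) U(z')⁻¹ w` is the solution with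
value `w` at `z'`. The radius depends neither on `z'` nor on `w`; this uniformity is what prevents
continuation along a path from stopping early. -/
theorem exists_flat_ball [CompleteSpace E] (S : SingularConnection Ω E) {z : ℂ} (hz : z ∉ Ω) :
    ∃ r > 0, ∀ z' ∈ Metric.ball z r, ∀ w : E, ∃ W, S.IsLeaf (Metric.ball z r) W ∧ W z' = w := by
  obtain ⟨U, hU1, hU⟩ := exists_fundamental_solution (S.coef_analyticAt z hz)
  have hcont : ContinuousAt U z := hU.self_of_nhds.continuousAt
  have hunit : ∀ᶠ y in 𝓝 z, IsUnit (U y) :=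
    hcont.eventually (Units.isOpen.mem_nhds (by rw [hU1]; exact isUnit_one))
  obtain ⟨r, hr, hball⟩ := Metric.eventually_nhds_iff_ball.1
    ((hU.and hunit).and (S.isClosed.isOpen_compl.mem_nhds hz))
  refine ⟨r, hr, fun z' hz' w => ?_⟩
  obtain ⟨u, hu⟩ := (hball z' hz').1.2
  refine ⟨fun y => U y ((↑u⁻¹ : E →L[ℂ] E) w), Or.inl ⟨Set.disjoint_left.2 fun y hy =>
    (hball y hy).2, fun y hy => ?_⟩, ?_⟩
  · exact (ContinuousLinearMap.apply ℂ E ((↑u⁻¹ : E →L[ℂ] E) w)).hasFDerivAt.comp_hasDerivAt y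
      (hball y hy).1.1
  · simp only [← hu]
    exact congrArg (fun T : E →L[ℂ] E => T w) u.mul_inv

variable (S)

/-- The space of germs of local solutions. A germ is given by its base point and by its value. -/
def Etale : Type _ := {x : ℂ × E // x.1 ∈ Ω → x = (0, S.germ 0)}

namespace Etale

variable {S}

/-- The base point of a germ. -/
def pt (x : S.Etale) : ℂ := x.1.1

/-- The value of a germ. -/
def val (x : S.Etale) : E := x.1.2

theorem ext_iff' {x y : S.Etale} : x = y ↔ x.pt = y.pt ∧ x.val = y.val :=
  Subtype.ext_iff.trans Prod.ext_iff

/-- The germs of a local solution. -/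
def sheet (S : SingularConnection Ω E) (U : Set ℂ) (W : ℂ → E) : Set S.Etale :=
  {x | x.pt ∈ U ∧ x.val = W x.pt}

theorem injOn_sheet (U : Set ℂ) (W : ℂ → E) : Set.InjOn pt (sheet S U W) := fun x hx y hy h =>
  ext_iff'.2 ⟨h, by rw [hx.2, hy.2, h]⟩

theorem sheet_mono {U V : Set ℂ} {W : ℂ → E} (h : U ⊆ V) : sheet S U W ⊆ sheet S V W :=
  fun _ hx => ⟨h hx.1, hx.2⟩

theorem sheet_congr {U : Set ℂ} {W₁ W₂ : ℂ → E} (h : Set.EqOn W₁ W₂ U) :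
    sheet S U W₁ = sheet S U W₂ := by
  ext x
  exact and_congr_right fun hx => by rw [h hx]

end Etale

/-- The germ at a given point of a local solution. -/
def IsLeaf.point {S : SingularConnection Ω E} {U : Set ℂ} {W : ℂ → E} (h : S.IsLeaf U W) {z : ℂ}
    (hz : z ∈ U) : S.Etale :=
  ⟨(z, W z), h.eq_base_of_mem hz⟩

/-- The germ at `0` of the distinguished solution. -/
def base : S.Etale := ⟨(0, S.germ 0), fun _ => rfl⟩

variable {S}

theorem Etale.exists_leaf [CompleteSpace E] (x : S.Etale) :
    ∃ r > 0, ∃ W, S.IsLeaf (Metric.ball x.pt r) W ∧ x.val = W x.pt := by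
  by_cases hx : x.pt ∈ Ω
  · have h := Prod.ext_iff.1 (x.2 hx)
    refine ⟨S.radius, S.radius_pos, S.germ, ?_, ?_⟩
    · rw [show x.pt = 0 from h.1]
      exact S.isLeaf_germ
    · rw [show x.pt = 0 from h.1]
      exact h.2
  · obtain ⟨r, hr, h⟩ := S.exists_flat_ball hx
    obtain ⟨W, hW, hWx⟩ := h x.pt (Metric.mem_ball_self hr) x.val
    exact ⟨r, hr, W, hW, hWx.symm⟩

/-- The leaf topology: neighbourhoods follow local solutions and are discrete along the fibres. It
is finer than the topology induced from `ℂ × E`. Over `Ω` only the distinguished germ at `0` is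
kept, so that lifts can leave `0` in one way only. -/
instance [CompleteSpace E] : TopologicalSpace S.Etale where
  IsOpen V := ∀ x ∈ V, ∃ r > 0, ∃ W, S.IsLeaf (Metric.ball x.pt r) W ∧ x.val = W x.pt ∧
    Etale.sheet S (Metric.ball x.pt r) W ⊆ V
  isOpen_univ x _ := by
    obtain ⟨r, hr, W, hW, hx⟩ := x.exists_leaf
    exact ⟨r, hr, W, hW, hx, Set.subset_univ _⟩
  isOpen_inter V₁ V₂ h₁ h₂ x hx := by
    obtain ⟨r₁, hr₁, W₁, hW₁, hx₁, hV₁⟩ := h₁ x hx.1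
    obtain ⟨r₂, hr₂, W₂, hW₂, hx₂, hV₂⟩ := h₂ x hx.2
    have s₁ := Metric.ball_subset_ball (x := x.pt) (min_le_left r₁ r₂)
    have s₂ := Metric.ball_subset_ball (x := x.pt) (min_le_right r₁ r₂)
    refine ⟨min r₁ r₂, lt_min hr₁ hr₂, W₁, hW₁.mono s₁, hx₁, Set.subset_inter
      ((Etale.sheet_mono s₁).trans hV₁) ?_⟩
    rw [Etale.sheet_congr ((hW₁.mono s₁).eqOn (hW₂.mono s₂) (convex_ball _ _)
      (Metric.mem_ball_self (lt_min hr₁ hr₂)) (hx₁ ▸ hx₂ ▸ rfl))]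
    exact (Etale.sheet_mono s₂).trans hV₂
  isOpen_sUnion 𝒱 h x := by
    rintro ⟨V, hV, hx⟩
    obtain ⟨r, hr, W, hW, hxW, hVW⟩ := h V hV x hx
    exact ⟨r, hr, W, hW, hxW, hVW.trans (Set.subset_sUnion_of_mem hV)⟩

/-! ### The projection of the étale space: a separated local homeomorphism. -/

namespace Etale

variable [CompleteSpace E]

theorem isOpen_iff {V : Set S.Etale} : IsOpen V ↔ ∀ x ∈ V, ∃ r > 0, ∃ W,
    S.IsLeaf (Metric.ball x.pt r) W ∧ x.val = W x.pt ∧ sheet S (Metric.ball x.pt r) W ⊆ V :=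
  Iff.rfl

theorem isOpen_sheet {U : Set ℂ} {W : ℂ → E} (h : S.IsLeaf U W) (hU : IsOpen U) :
    IsOpen (sheet S U W) := by
  refine isOpen_iff.2 fun x hx => ?_
  obtain ⟨r, hr, hrU⟩ := Metric.isOpen_iff.1 hU _ hx.1
  exact ⟨r, hr, W, h.mono hrU, hx.2, sheet_mono hrU⟩

theorem continuous_pt : Continuous (pt : S.Etale → ℂ) := by
  refine continuous_def.2 fun V hV => isOpen_iff.2 fun x hx => ?_
  obtain ⟨r, hr, W, hW, hxW⟩ := x.exists_leaf
  obtain ⟨r', hr', hrV⟩ := Metric.isOpen_iff.1 hV _ hx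
  exact ⟨min r r', lt_min hr hr', W, hW.mono (Metric.ball_subset_ball (min_le_left _ _)), hxW,
    fun y hy => hrV (Metric.ball_subset_ball (min_le_right _ _) hy.1)⟩

theorem isOpenMap_pt : IsOpenMap (pt : S.Etale → ℂ) := by
  refine fun V hV => Metric.isOpen_iff.2 ?_
  rintro _ ⟨x, hx, rfl⟩
  obtain ⟨r, hr, W, hW, hxW, hV⟩ := isOpen_iff.1 hV x hx
  exact ⟨r, hr, fun z hz => ⟨hW.point hz, hV ⟨hz, rfl⟩, rfl⟩⟩

theorem isLocalHomeomorph_pt : IsLocalHomeomorph (pt : S.Etale → ℂ) := by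
  refine isLocalHomeomorph_iff_isOpenEmbedding_restrict.2 fun x => ?_
  obtain ⟨r, hr, W, hW, hxW⟩ := x.exists_leaf
  have ho := isOpen_sheet hW Metric.isOpen_ball
  refine ⟨sheet S (Metric.ball x.pt r) W, ho.mem_nhds ⟨Metric.mem_ball_self hr, hxW⟩, ?_⟩
  exact .of_continuous_injective_isOpenMap (continuous_pt.comp continuous_subtype_val)
    (Set.injOn_iff_injective.1 (injOn_sheet _ _)) (isOpenMap_pt.domRestrict ho)

/-- If the sheets of two germs over the same point, taken on a common disc, shared an element,
uniqueness would identify them on the whole disc and the germs would be equal. -/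
theorem isSeparatedMap_pt : IsSeparatedMap (pt : S.Etale → ℂ) := by
  intro x y hxy hne
  obtain ⟨r₁, hr₁, W₁, hW₁, hx₁⟩ := x.exists_leaf
  obtain ⟨r₂, hr₂, W₂, hW₂, hx₂⟩ := y.exists_leaf
  rw [← hxy] at hW₂ hx₂
  have s₁ := Metric.ball_subset_ball (x := x.pt) (min_le_left r₁ r₂)
  have s₂ := Metric.ball_subset_ball (x := x.pt) (min_le_right r₁ r₂)
  have hm := Metric.mem_ball_self (x := x.pt) (lt_min hr₁ hr₂)
  refine ⟨_, _, isOpen_sheet (hW₁.mono s₁) Metric.isOpen_ball,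
    isOpen_sheet (hW₂.mono s₂) Metric.isOpen_ball, ⟨hm, hx₁⟩, ⟨hxy ▸ hm, hxy ▸ hx₂⟩, ?_⟩
  refine Set.disjoint_left.2 fun u hu₁ hu₂ => hne (ext_iff'.2 ⟨hxy, ?_⟩)
  rw [hx₁, hx₂]
  exact (hW₁.mono s₁).eqOn (hW₂.mono s₂) (convex_ball _ _) hu₁.1 (hu₁.2 ▸ hu₂.2) hm

theorem continuous_val : Continuous (val : S.Etale → E) := by
  refine continuous_iff_continuousAt.2 fun x => ?_
  obtain ⟨r, hr, W, hW, hxW⟩ := x.exists_leaf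
  have hm := Metric.mem_ball_self (x := x.pt) hr
  have h1 : ContinuousAt (fun y : S.Etale => W y.pt) x :=
    (hW.analyticAt Metric.isOpen_ball hm).continuousAt.comp continuous_pt.continuousAt
  refine h1.congr ?_
  filter_upwards [(isOpen_sheet hW Metric.isOpen_ball).mem_nhds ⟨hm, hxW⟩] with y hy
  exact hy.2.symm

/-- The projection restricted to a sheet is an open embedding, so continuity can be tested after
projecting. -/
theorem continuousOn_of_mem_sheet {X : Type*} [TopologicalSpace X] {s : Set X} {Γ : X → S.Etale}
    {U : Set ℂ} {W : ℂ → E} (hW : S.IsLeaf U W) (hU : IsOpen U)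
    (hpt : ContinuousOn (fun t => (Γ t).pt) s) (hΓ : ∀ t ∈ s, Γ t ∈ sheet S U W) :
    ContinuousOn Γ s := by
  intro t ht
  have ho := isOpen_sheet hW hU
  have he : Topology.IsOpenEmbedding ((sheet S U W).domRestrict pt) :=
    .of_continuous_injective_isOpenMap (continuous_pt.comp continuous_subtype_val)
      (Set.injOn_iff_injective.1 (injOn_sheet _ _)) (isOpenMap_pt.domRestrict ho)
  rw [ContinuousWithinAt, Filter.tendsto_def]
  intro V hV
  have h1 : (fun y : sheet S U W => (y : S.Etale)) ⁻¹' V ∈ 𝓝 (⟨Γ t, hΓ t ht⟩ : sheet S U W) :=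
    continuous_subtype_val.continuousAt hV
  have h2 := he.image_mem_nhds.2 h1
  filter_upwards [hpt t ht h2, self_mem_nhdsWithin] with u hu hus
  obtain ⟨y, hy, hyu⟩ := hu
  have : (y : S.Etale) = Γ u := injOn_sheet U W y.2 (hΓ u hus) hyu
  rw [Set.mem_preimage, ← this]
  exact hy

end Etale

end SingularConnection

/-! ### Basic neighbourhoods on the Riemann surface. -/

namespace RSurface

variable {Ω : Set ℂ}

/-- A basic neighbourhood consists of classes of concatenations, so `γ` must be shown homotopic to
`γ` followed by a constant path. The homotopy only reparametrizes time by monotone maps, and these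
preserve admissibility. -/
theorem mem_nbhd_self (γ : AdmPath Ω) {r : ℝ} (hr : 0 < r) :
    mk γ.path γ.adm ∈ nbhd γ r := by
  let φ : I → I → I := fun s t => ⟨(1 - s) * t + s * min (2 * (t : ℝ)) 1, by
    have := s.2.1; have := s.2.2; have := t.2.1; have := t.2.2
    have h1 : (0 : ℝ) ≤ min (2 * (t : ℝ)) 1 := le_min (by linarith) zero_le_one
    have h2 : min (2 * (t : ℝ)) 1 ≤ 1 := min_le_right _ _
    constructor
    · have : (0 : ℝ) ≤ 1 - s := by linarith
      positivity
    · nlinarith⟩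
  have hφc : Continuous fun x : I × I => φ x.1 x.2 := by
    refine Continuous.subtype_mk ?_ _
    fun_prop
  have hφm : ∀ s, Monotone (φ s) := fun s t t' h => by
    have h' : (t : ℝ) ≤ t' := h
    have := s.2.1; have := s.2.2
    have h1 : (0 : ℝ) ≤ 1 - s := by linarith
    change (1 - (s : ℝ)) * t + s * min (2 * (t : ℝ)) 1 ≤
      (1 - (s : ℝ)) * t' + s * min (2 * (t' : ℝ)) 1
    gcongr
  have hφ0 : ∀ s, φ s 0 = 0 := fun s => Subtype.ext (by simp [φ])
  have hφ1 : ∀ s, φ s 1 = 1 := fun s => Subtype.ext (by simp [φ])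
  have hadm : ∀ s (g : C(I, ℂ)), (∀ t, g t = γ.path (φ s t)) → Admissible Ω g := by
    intro s g hg
    refine ⟨by rw [hg, hφ0, γ.path.source], fun t ht t' htt' => ?_⟩
    rw [hg] at ht ⊢
    exact γ.adm.2 _ ht _ (hφm s htt')
  have htr : ∀ t, (γ.path.trans (Path.refl γ.endpt)) t = γ.path (φ 1 t) := by
    intro t
    rw [Path.trans_apply]
    split_ifs with h
    · refine congrArg γ.path (Subtype.ext ?_)
      simp only [φ, Set.Icc.coe_one, sub_self, zero_mul, one_mul, zero_add]
      rw [min_eq_left (by linarith)]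
    · have : φ 1 t = 1 := by
        refine Subtype.ext ?_
        simp only [φ, Set.Icc.coe_one, sub_self, zero_mul, one_mul, zero_add]
        rw [min_eq_right (by linarith)]
      rw [this, γ.path.target]
      rfl
  refine ⟨γ.endpt, Path.refl _, hadm 1 _ htr, fun t => Metric.mem_ball_self hr, ?_⟩
  refine Quotient.sound (s := admSetoid Ω) ⟨?_⟩
  refine { toFun := fun x => γ.path (φ x.1 x.2), continuous_toFun := γ.path.continuous.comp hφc,
           map_zero_left := fun t => ?_, map_one_left := fun t => ?_, prop' := fun s => ?_ }
  · exact congrArg γ.path (Subtype.ext (by simp [φ]))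
  · exact (htr t).symm
  · refine ⟨hadm s _ fun t => rfl, ?_⟩
    exact (congrArg γ.path (hφ1 s)).trans γ.path.target

theorem nbhd_mem_nhds (γ : AdmPath Ω) {r : ℝ} (hr : 0 < r) :
    nbhd γ r ∈ 𝓝 (mk γ.path γ.adm) :=
  IsOpen.mem_nhds (TopologicalSpace.isOpen_generateFrom_of_mem ⟨γ, r, hr, rfl⟩)
    (mem_nbhd_self γ hr)

theorem exists_eq_mk (q : RSurface Ω) :
    ∃ γ : AdmPath Ω, q = mk γ.path γ.adm :=
  ⟨Quotient.out q, (Quotient.out_eq q).symm⟩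

end RSurface

namespace SingularConnection

/-! ### Continuation along admissible paths -/

variable {Ω : Set ℂ} {E : Type*} [NormedAddCommGroup E] [NormedSpace ℂ E] [CompleteSpace E]
  (S : SingularConnection Ω E)

/-- A lift of a path to the étale space, from one germ to another one. -/
def Transports (x : S.Etale) (γ : I → ℂ) (y : S.Etale) : Prop :=
  ∃ Γ : C(I, S.Etale), Γ 0 = x ∧ Γ 1 = y ∧ ∀ t, (Γ t).pt = γ t

variable {S}

namespace Transports

variable {x y y' : S.Etale} {γ : I → ℂ}

theorem pt_right (h : S.Transports x γ y) : y.pt = γ 1 := by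
  obtain ⟨Γ, -, rfl, h⟩ := h
  exact h 1

theorem unique (h : S.Transports x γ y) (h' : S.Transports x γ y') : y = y' := by
  obtain ⟨Γ, h0, rfl, hγ⟩ := h
  obtain ⟨Γ', h0', rfl, hγ'⟩ := h'
  refine congr_fun (Etale.isSeparatedMap_pt.eq_of_comp_eq
    Etale.isLocalHomeomorph_pt.isLocallyInjective Γ.continuous Γ'.continuous ?_ 0
    (h0.trans h0'.symm)) 1
  exact funext fun t => (hγ t).trans (hγ' t).symm

theorem of_mem_leaf {γ : I → ℂ} (hγ : Continuous γ) {U : Set ℂ} {W : ℂ → E} (hW : S.IsLeaf U W)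
    (hU : IsOpen U) (h : ∀ t, γ t ∈ U) :
    S.Transports (hW.point (h 0)) γ (hW.point (h 1)) := by
  refine ⟨⟨fun t => hW.point (h t), ?_⟩, rfl, rfl, fun t => rfl⟩
  rw [← continuousOn_univ]
  exact Etale.continuousOn_of_mem_sheet hW hU hγ.continuousOn fun t _ => ⟨h t, rfl⟩

theorem trans_iff {z₀ z₁ z₂ : ℂ} {γ : Path z₀ z₁} {η : Path z₁ z₂} :
    S.Transports x (γ.trans η) y ↔ ∃ m, S.Transports x γ m ∧ S.Transports m η y := by
  constructor
  · rintro ⟨Γ, h0, h1, h⟩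
    let a : C(I, I) := ⟨fun t => ⟨(t : ℝ) / 2, by constructor <;> linarith [t.2.1, t.2.2]⟩,
      by fun_prop⟩
    let b : C(I, I) := ⟨fun t => ⟨((t : ℝ) + 1) / 2, by constructor <;> linarith [t.2.1, t.2.2]⟩,
      by fun_prop⟩
    refine ⟨Γ (a 1), ⟨Γ.comp a, ?_, rfl, fun t => ?_⟩, ⟨Γ.comp b, ?_, ?_, fun t => ?_⟩⟩
    · rw [← h0]
      exact congrArg Γ (Subtype.ext (by simp [a]))
    · rw [ContinuousMap.comp_apply, h, Path.trans_apply, dif_pos]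
      · exact congrArg γ (Subtype.ext (by simp [a]; ring))
      · simp only [a, ContinuousMap.coe_mk]; linarith [t.2.2]
    · exact congrArg Γ (Subtype.ext (by simp [a, b]))
    · rw [← h1]
      exact congrArg Γ (Subtype.ext (by simp [b]))
    · rw [ContinuousMap.comp_apply, h, Path.trans_apply]
      split_ifs with hb
      · have ht : t = 0 := by
          simp only [b, ContinuousMap.coe_mk] at hb
          exact Subtype.ext (le_antisymm (by simp; linarith) t.2.1)
        subst ht
        rw [η.source]
        have : (⟨2 * ((b 0 : I) : ℝ), (unitInterval.mul_pos_mem_iff zero_lt_two).2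
          ⟨(b 0).2.1, hb⟩⟩ : I) = 1 := Subtype.ext (by simp [b])
        rw [this, γ.target]
      · exact congrArg η (Subtype.ext (by simp [b]; ring))
  · rintro ⟨m, ⟨Γ, h0, h1, h⟩, ⟨Γ', h0', h1', h'⟩⟩
    let P : Path x m := ⟨Γ, h0, h1⟩
    let P' : Path m y := ⟨Γ', h0', h1'⟩
    refine ⟨(P.trans P').toContinuousMap, (P.trans P').source, (P.trans P').target, fun t => ?_⟩
    change ((P.trans P') t).pt = _
    rw [Path.trans_apply, Path.trans_apply]
    split_ifs
    · exact h _
    · exact h' _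

end Transports

/-- Every admissible path can be lifted to the étale space. -/
theorem exists_transports {γ : C(I, ℂ)} (hγ : Admissible Ω γ) :
    ∃ y, S.Transports S.base γ y := by
  have hcover : ∀ t : I, ∃ V : Set I, IsOpen V ∧ t ∈ V ∧
      ((∀ s ∈ V, ∀ s' ≤ s, γ s' ∈ Metric.ball 0 S.radius) ∨
        ∃ z r, (∀ z' ∈ Metric.ball z r, ∀ w : E, ∃ W, S.IsLeaf (Metric.ball z r) W ∧ W z' = w) ∧
          ∀ s ∈ V, γ s ∈ Metric.ball z r) := by
    intro t
    -- Two kinds of time intervals. If `γ t ∈ Ω`, the path has stayed at `0` up to time `t`, so for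
    -- nearby times the whole past lies in the disc of the germ. Otherwise the path runs for a while
    -- in a ball where every initial value extends.
    by_cases ht : γ t ∈ Ω
    · have h0 := hγ.2 t ht
      have hn : γ ⁻¹' Metric.ball 0 S.radius ∈ 𝓝 t :=
        γ.continuous.continuousAt (Metric.isOpen_ball.mem_nhds
          (by rw [h0 t le_rfl]; exact Metric.mem_ball_self S.radius_pos))
      obtain ⟨ε, hε, hball⟩ := Metric.mem_nhds_iff.1 hn
      refine ⟨Metric.ball t ε, Metric.isOpen_ball, Metric.mem_ball_self hε, Or.inl ?_⟩
      intro s hs s' hs'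
      rcases le_total s' t with h | h
      · rw [h0 s' h]
        exact Metric.mem_ball_self S.radius_pos
      · apply hball
        rw [Metric.mem_ball, Subtype.dist_eq, Real.dist_eq, abs_lt] at hs ⊢
        have h1 : (s' : ℝ) ≤ s := hs'
        have h2 : (t : ℝ) ≤ s' := h
        constructor <;> linarith [hs.1, hs.2]
    · obtain ⟨r, hr, h⟩ := S.exists_flat_ball ht
      exact ⟨γ ⁻¹' Metric.ball (γ t) r, Metric.isOpen_ball.preimage γ.continuous,
        Metric.mem_ball_self hr, Or.inr ⟨γ t, r, h, fun s hs => hs⟩⟩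
  choose V hVo htV hV using hcover
  obtain ⟨τ, τ0, τmono, ⟨N, hN⟩, hτ⟩ := exists_monotone_Icc_subset_open_cover_unitInterval hVo
    fun t _ => Set.mem_iUnion.2 ⟨t, htV t⟩
  have key : ∀ n, ∃ Γ : I → S.Etale, ContinuousOn Γ (Set.Icc 0 (τ n)) ∧
      (∀ t ∈ Set.Icc 0 (τ n), (Γ t).pt = γ t) ∧ Γ 0 = S.base := by
    intro n
    induction n with
    | zero =>
      refine ⟨fun _ => S.base, continuousOn_const, fun t ht => ?_, rfl⟩
      rw [τ0, Set.Icc_self, Set.mem_singleton_iff] at ht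
      subst ht
      exact hγ.1.symm
    | succ n ih =>
      obtain ⟨Γ, hΓ, hΓγ, hΓ0⟩ := ih
      obtain ⟨i, hi⟩ := hτ n
      have hn1 : τ n ≤ τ (n + 1) := τmono n.le_succ
      have h0n : 0 ≤ τ n := τ0 ▸ τmono n.zero_le
      classical
      rcases hV i with hVi | ⟨z, r, hflat, hVi⟩
      -- The whole past lies in the disc of the germ, so the lift built so far is discarded and
      -- replaced by the values of the germ.
      · have hm : ∀ t ∈ Set.Icc 0 (τ (n + 1)), γ t ∈ Metric.ball 0 S.radius := fun t ht =>
          hVi (τ (n + 1)) (hi ⟨hn1, le_rfl⟩) t ht.2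
        let Γ' : I → S.Etale := fun t =>
          if h : γ t ∈ Metric.ball 0 S.radius then S.isLeaf_germ.point h else S.base
        have hv : ∀ t (ht : t ∈ Set.Icc 0 (τ (n + 1))), Γ' t = S.isLeaf_germ.point (hm t ht) :=
          fun t ht => dif_pos (hm t ht)
        refine ⟨Γ', Etale.continuousOn_of_mem_sheet S.isLeaf_germ Metric.isOpen_ball
          (γ.continuous.continuousOn.congr fun t ht => ?_) (fun t ht => ?_), fun t ht => ?_, ?_⟩
        · exact congrArg Etale.pt (hv t ht)
        · rw [hv t ht]
          exact ⟨hm t ht, rfl⟩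
        · rw [hv t ht]
          rfl
        · rw [hv 0 ⟨le_rfl, h0n.trans hn1⟩]
          exact Etale.ext_iff'.2 ⟨hγ.1, congrArg S.germ hγ.1⟩
      · have hm : ∀ t ∈ Set.Icc (τ n) (τ (n + 1)), γ t ∈ Metric.ball z r := fun t ht =>
          hVi t (hi ht)
        obtain ⟨W, hW, hWn⟩ := hflat (γ (τ n)) (hm _ ⟨le_rfl, hn1⟩) (Γ (τ n)).val
        let Γ' : I → S.Etale := fun t => if t ≤ τ n then Γ t else
          if h : γ t ∈ Metric.ball z r then hW.point h else S.base
        have h1 : ∀ t ∈ Set.Icc 0 (τ n), Γ' t = Γ t := fun t ht => if_pos ht.2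
        have h2 : ∀ t (ht : t ∈ Set.Icc (τ n) (τ (n + 1))), Γ' t = hW.point (hm t ht) := by
          intro t ht
          rcases ht.1.eq_or_lt with h | h
          · subst h
            rw [h1 _ ⟨h0n, le_rfl⟩]
            exact Etale.ext_iff'.2 ⟨hΓγ _ ⟨h0n, le_rfl⟩, hWn.symm⟩
          · simp only [Γ']
            rw [if_neg h.not_ge, dif_pos (hm t ht)]
        refine ⟨Γ', ?_, fun t ht => ?_, ?_⟩
        · rw [← Set.Icc_union_Icc_eq_Icc h0n hn1]
          refine ContinuousOn.union_of_isClosed (hΓ.congr h1) ?_ isClosed_Icc isClosed_Icc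
          refine Etale.continuousOn_of_mem_sheet hW Metric.isOpen_ball
            (γ.continuous.continuousOn.congr fun t ht => ?_) (fun t ht => ?_)
          · exact congrArg Etale.pt (h2 t ht)
          · rw [h2 t ht]
            exact ⟨hm t ht, rfl⟩
        · rcases le_total t (τ n) with h | h
          · rw [h1 t ⟨ht.1, h⟩]
            exact hΓγ t ⟨ht.1, h⟩
          · rw [h2 t ⟨h, ht.2⟩]
            rfl
        · rw [h1 0 ⟨le_rfl, h0n⟩, hΓ0]
  obtain ⟨Γ, hΓ, hΓγ, hΓ0⟩ := key N
  have hall : ∀ t : I, t ∈ Set.Icc 0 (τ N) := fun t => ⟨t.2.1, by rw [hN N le_rfl]; exact t.2.2⟩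
  refine ⟨Γ 1, ⟨Γ, ?_⟩, hΓ0, rfl, fun t => hΓγ t (hall t)⟩
  rw [← continuousOn_univ]
  exact hΓ.mono fun t _ => hall t

/-- Each intermediate path of the homotopy is admissible and thus lifts from the base germ. The
monodromy theorem for separated local homeomorphisms then makes the end-point of the lift constant.
-/
theorem Transports.eq_of_homotopic {γ₀ γ₁ : AdmPath Ω} (h : γ₀.Homotopic γ₁) {y₀ y₁ : S.Etale}
    (h₀ : S.Transports S.base γ₀.path y₀) (h₁ : S.Transports S.base γ₁.path y₁) : y₀ = y₁ := by
  obtain ⟨H⟩ := h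
  have hex : ∀ s, ∃ Γ : C(I, S.Etale), Γ 0 = S.base ∧ ∀ t, (Γ t).pt = H (s, t) := fun s => by
    obtain ⟨y, Γ, h0, -, h⟩ := exists_transports (S := S) (H.prop s).1
    exact ⟨Γ, h0, h⟩
  choose Γ hΓ0 hΓ using hex
  have hrel : ∀ s, ∀ t ∈ ({0, 1} : Set I), H (s, t) = γ₀.path.toContinuousMap t := by
    rintro s t (rfl | rfl)
    · exact (H.prop s).1.1.trans γ₀.path.source.symm
    · exact (H.prop s).2.trans γ₀.path.target.symm
  let H' : γ₀.path.toContinuousMap.HomotopyRel γ₁.path.toContinuousMap {0, 1} :=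
    { H.toHomotopy with prop' := hrel }
  have key := Etale.isLocalHomeomorph_pt.monodromy_theorem Etale.isSeparatedMap_pt H' Γ hΓ
    (fun s => (hΓ0 s).trans (hΓ0 0).symm) 1
  have e0 : S.Transports S.base γ₀.path (Γ 0 1) :=
    ⟨Γ 0, hΓ0 0, rfl, fun t => (hΓ 0 t).trans (H.apply_zero t)⟩
  have e1 : S.Transports S.base γ₁.path (Γ 1 1) :=
    ⟨Γ 1, hΓ0 1, rfl, fun t => (hΓ 1 t).trans (H.apply_one t)⟩
  rw [h₀.unique e0, h₁.unique e1, key]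

variable (S)

/-- The continuation of the germ to the surface of `Ω`. -/
def continuation : RSurface Ω → S.Etale :=
  Quotient.lift (fun γ => (exists_transports (S := S) γ.adm).choose) fun γ₀ γ₁ h =>
    Transports.eq_of_homotopic h (exists_transports γ₀.adm).choose_spec
      (exists_transports γ₁.adm).choose_spec

variable {S}

theorem transports_continuation {z : ℂ} (γ : Path (0 : ℂ) z)
    (h : Admissible Ω γ.toContinuousMap) :
    S.Transports S.base γ (S.continuation (RSurface.mk γ h)) :=
  (exists_transports (S := S) h).choose_spec

theorem continuation_eq_iff {z : ℂ} (γ : Path (0 : ℂ) z) (h : Admissible Ω γ.toContinuousMap)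
    {y : S.Etale} : S.continuation (RSurface.mk γ h) = y ↔ S.Transports S.base γ y :=
  ⟨fun e => e ▸ transports_continuation γ h, fun hy => (transports_continuation γ h).unique hy⟩

theorem pt_continuation (q : RSurface Ω) : (S.continuation q).pt = q.proj := by
  obtain ⟨γ, rfl⟩ := q.exists_eq_mk
  exact (transports_continuation γ.path γ.adm).pt_right.trans γ.path.target

/-- Near the class of a path, the continuation is given by a local solution. -/
theorem continuation_eventually_val (γ : AdmPath Ω) {U : Set ℂ} {W : ℂ → E} (hW : S.IsLeaf U W)
    (hU : IsOpen U)
    (hγ : S.continuation (RSurface.mk γ.path γ.adm) ∈ Etale.sheet S U W) :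
    ∀ᶠ q in 𝓝 (RSurface.mk γ.path γ.adm), (S.continuation q).val = W q.proj := by
  have hpt := pt_continuation (S := S) (RSurface.mk γ.path γ.adm)
  change _ = γ.endpt at hpt
  obtain ⟨r, hr, hrU⟩ := Metric.isOpen_iff.1 hU _ (hpt ▸ hγ.1)
  filter_upwards [RSurface.nbhd_mem_nhds γ hr]
  rintro q ⟨z, η, h, hη, rfl⟩
  have hηU : ∀ t, η t ∈ U := fun t => hrU (hη t)
  have h1 := transports_continuation (S := S) γ.path γ.adm
  have h2 := Transports.of_mem_leaf η.continuous hW hU hηU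
  have h3 : S.continuation (RSurface.mk γ.path γ.adm) = hW.point (hηU 0) := by
    have e : η 0 = γ.endpt := η.source
    refine Etale.ext_iff'.2 ⟨hpt.trans e.symm, hγ.2.trans ?_⟩
    exact congrArg W (hpt.trans e.symm)
  rw [(continuation_eq_iff _ h).2 (Transports.trans_iff.2 ⟨_, h1, h3 ▸ h2⟩)]
  exact congrArg W η.target

theorem isAnalytic_continuation (L : E →L[ℂ] ℂ) :
    RSurface.IsAnalytic fun q : RSurface Ω => L (S.continuation q).val := by
  intro p
  obtain ⟨γ, rfl⟩ := p.exists_eq_mk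
  obtain ⟨r, hr, W, hW, hval⟩ := (S.continuation (RSurface.mk γ.path γ.adm)).exists_leaf
  have hm := Metric.mem_ball_self (x := (S.continuation (RSurface.mk γ.path γ.adm)).pt) hr
  refine ⟨fun z => L (W z), ?_, ?_⟩
  · rw [← pt_continuation (S := S)]
    exact (L.analyticAt _).comp (hW.analyticAt Metric.isOpen_ball hm)
  · filter_upwards [continuation_eventually_val γ hW Metric.isOpen_ball ⟨hm, hval⟩] with q hq
    rw [hq]

theorem transports_base_refl : S.Transports S.base (Path.refl (0 : ℂ)) S.base :=
  ⟨.const I S.base, rfl, rfl, fun _ => rfl⟩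

theorem continuation_origin_eventually :
    ∀ᶠ q in 𝓝 (RSurface.origin Ω), (S.continuation q).val = S.germ q.proj ∧
      q.proj ∈ Metric.ball 0 S.radius := by
  have h0 : S.continuation (RSurface.origin Ω) = S.base :=
    (continuation_eq_iff _ _).2 transports_base_refl
  let γ₀ : AdmPath Ω := ⟨0, Path.refl 0, rfl, fun _ _ _ _ => rfl⟩
  have h1 : S.continuation (RSurface.mk γ₀.path γ₀.adm) ∈
      Etale.sheet S (Metric.ball 0 S.radius) S.germ := by
    rw [show S.continuation (RSurface.mk γ₀.path γ₀.adm) = S.base from h0]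
    exact ⟨Metric.mem_ball_self S.radius_pos, rfl⟩
  refine (continuation_eventually_val γ₀ S.isLeaf_germ Metric.isOpen_ball h1).and ?_
  · filter_upwards [RSurface.nbhd_mem_nhds γ₀ S.radius_pos]
    rintro q ⟨z, η, h, hη, rfl⟩
    have h1 := hη 1
    rwa [η.target] at h1

end SingularConnection

/-! ### The base path of a sectorial region, and segments in polar coordinates. -/

namespace SectorialRegion

variable {Ω : Set ℂ} {ν : ℝ}

theorem notMem_of_dist {z : ℂ} (Δ : SectorialRegion Ω ν)
    (h : ∀ a ∈ Ω, ν < dist z a) : z ∉ Ω := fun hz => by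
  have := h z hz
  rw [dist_self] at this
  exact absurd this Δ.ν_pos.not_gt

theorem γ_dist (Δ : SectorialRegion Ω ν) (t : I) :
    ∀ a ∈ Ω, ν < dist (Δ.γ t) a := Δ.N_dist t _ (Metric.mem_ball_self Δ.w_pos)

/-- The segment from `0` to the starting point of `γ`, followed by `γ`, is admissible. -/
theorem admissible (Δ : SectorialRegion Ω ν)
    (h0 : (0 : ℂ) ∈ Ω) :
    Admissible Ω ((Path.segment 0 Δ.p).trans Δ.γ).toContinuousMap := by
  refine ⟨((Path.segment 0 Δ.p).trans Δ.γ).source, fun t ht s hs => ?_⟩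
  have hp0 : Δ.p ≠ 0 := fun h => by
    have h1 : Δ.γ 0 = 0 := Δ.γ.source.trans h
    exact Δ.notMem_of_dist (Δ.γ_dist 0) (h1 ▸ h0)
  -- The disc avoids `Ω \ {0}` and `γ` stays away from `Ω`, so the path meets `Ω` at time `0` only.
  have ht0 : t = 0 := by
    change ((Path.segment 0 Δ.p).trans Δ.γ) t ∈ Ω at ht
    rw [Path.trans_apply] at ht
    split_ifs at ht with h
    · rw [show ∀ u : I, (Path.segment 0 Δ.p) u = ((u : ℝ) : ℂ) * Δ.p from fun u => by
        simp [AffineMap.lineMap_apply]] at ht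
      by_contra hne
      have htpos : (0 : ℝ) < t := lt_of_le_of_ne t.2.1 fun e => hne (Subtype.ext e.symm)
      have hne' : (((2 * (t : ℝ) : ℝ) : ℂ)) * Δ.p ≠ 0 :=
        mul_ne_zero (by exact_mod_cast (by positivity : (2 * (t : ℝ)) ≠ 0)) hp0
      have hball : (((2 * (t : ℝ) : ℝ) : ℂ)) * Δ.p ∈ Metric.ball (0 : ℂ) Δ.d := by
        rw [mem_ball_zero_iff, norm_mul, Complex.norm_real, Real.norm_of_nonneg (by positivity)]
        exact (mul_le_of_le_one_left (norm_nonneg _) (by linarith)).trans_lt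
          (by simpa using Δ.p_mem)
      have := Δ.D_dist _ hball _ ⟨ht, hne'⟩
      rw [dist_self] at this
      exact absurd this Δ.ν_pos.not_gt
    · exact absurd ht (Δ.notMem_of_dist (Δ.γ_dist _))
  have hs0 : s = 0 := le_antisymm (ht0 ▸ hs) s.2.1
  subst hs0
  exact ((Path.segment 0 Δ.p).trans Δ.γ).source

end SectorialRegion

theorem norm_polar (x : ℝ × ℝ) : ‖polar x‖ = |x.1| := by
  rw [polar, norm_mul, Complex.norm_exp_ofReal_mul_I, mul_one, Complex.norm_real, Real.norm_eq_abs]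

theorem hasDerivAt_polar_lineMap (e x : ℝ × ℝ) (t : ℝ) :
    HasDerivAt (fun t : ℝ => polar (AffineMap.lineMap e x t))
      (((x.1 - e.1 : ℝ) +
          (((AffineMap.lineMap e x t : ℝ × ℝ).1 * (x.2 - e.2) : ℝ) : ℂ) * Complex.I) *
        Complex.exp (((AffineMap.lineMap e x t : ℝ × ℝ).2 : ℂ) * Complex.I)) t := by
  have h1 : HasDerivAt (fun t : ℝ => (((AffineMap.lineMap e x t : ℝ × ℝ).1 : ℝ) : ℂ))
      ((x.1 - e.1 : ℝ) : ℂ) t := by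
    refine HasDerivAt.ofReal_comp ?_
    have := ((hasDerivAt_id t).mul_const (x.1 - e.1)).add_const e.1
    simpa [AffineMap.lineMap_apply] using this
  have h2 : HasDerivAt (fun t : ℝ => (((AffineMap.lineMap e x t : ℝ × ℝ).2 : ℝ) : ℂ))
      ((x.2 - e.2 : ℝ) : ℂ) t := by
    refine HasDerivAt.ofReal_comp ?_
    have := ((hasDerivAt_id t).mul_const (x.2 - e.2)).add_const e.2
    simpa [AffineMap.lineMap_apply] using this
  refine (h1.mul (h2.mul_const Complex.I).cexp).congr_deriv ?_
  push_cast
  ring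

namespace SingularConnection

/-! ### Growth of the continuation on sectorial regions -/

variable {Ω : Set ℂ} {E : Type*} [NormedAddCommGroup E] [NormedSpace ℂ E] [CompleteSpace E]
  {S : SingularConnection Ω E}

/-- Grönwall's inequality along a lift: locally the value is a leaf composed with `δ`, so it solves
the equation pulled back by `δ`. The estimate starts at a time `t₁` because the coefficient is not
controlled near `0`. -/
theorem norm_val_le_of_lift {Γ : C(I, S.Etale)} {t₁ : I} {δ δ' : ℝ → ℂ} {K ℓ : ℝ}
    (hΓ : ∀ t : I, t₁ ≤ t → (Γ t).pt = δ t)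
    (hδ : ∀ t ∈ Set.Icc (t₁ : ℝ) 1, HasDerivAt δ (δ' t) t)
    (hℓ : ∀ t ∈ Set.Icc (t₁ : ℝ) 1, ‖δ' t‖ ≤ ℓ)
    (hΩ : ∀ t ∈ Set.Icc (t₁ : ℝ) 1, δ t ∉ Ω)
    (hK : ∀ t ∈ Set.Icc (t₁ : ℝ) 1, ‖S.coef (δ t)‖ ≤ K) :
    ‖(Γ 1).val‖ ≤ ‖(Γ t₁).val‖ * Real.exp (K * ℓ) := by
  have hm1 : (1 : ℝ) ∈ Set.Icc (t₁ : ℝ) 1 := ⟨t₁.2.2, le_rfl⟩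
  have hK0 : 0 ≤ K := (norm_nonneg _).trans (hK 1 hm1)
  have hℓ0 : 0 ≤ ℓ := (norm_nonneg _).trans (hℓ 1 hm1)
  set f : ℝ → E := fun t => (Γ (Set.projIcc 0 1 zero_le_one t)).val with hf
  have hfI : ∀ t : I, f t = (Γ t).val := fun t => by simp [hf]
  have hfc : Continuous f := Etale.continuous_val.comp (Γ.continuous.comp continuous_projIcc)
  have hder : ∀ t ∈ Set.Ico (t₁ : ℝ) 1,
      HasDerivWithinAt f (δ' t • S.coef (δ t) (f t)) (Set.Ici t) t := by
    intro t ht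
    have htI : t ∈ Set.Icc (0 : ℝ) 1 := ⟨t₁.2.1.trans ht.1, ht.2.le⟩
    have htc : t ∈ Set.Icc (t₁ : ℝ) 1 := Set.Ico_subset_Icc_self ht
    obtain ⟨r, hr, W, hW, hval⟩ := (Γ ⟨t, htI⟩).exists_leaf
    have hpt : (Γ ⟨t, htI⟩).pt = δ t := hΓ ⟨t, htI⟩ ht.1
    have hsheet : ∀ᶠ s in 𝓝 t, Γ (Set.projIcc 0 1 zero_le_one s) ∈
        Etale.sheet S (Metric.ball (Γ ⟨t, htI⟩).pt r) W := by
      refine (Γ.continuous.comp continuous_projIcc).continuousAt.eventually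
        ((Etale.isOpen_sheet hW Metric.isOpen_ball).mem_nhds ?_)
      simp only [Function.comp_apply, Set.projIcc_of_mem zero_le_one htI]
      exact ⟨Metric.mem_ball_self hr, hval⟩
    have heq : ∀ s ∈ Set.Icc t 1, Γ (Set.projIcc 0 1 zero_le_one s) ∈
        Etale.sheet S (Metric.ball (Γ ⟨t, htI⟩).pt r) W → f s = W (δ s) := by
      intro s hs hmem
      have hsI : s ∈ Set.Icc (0 : ℝ) 1 := ⟨htI.1.trans hs.1, hs.2⟩
      rw [Set.projIcc_of_mem zero_le_one hsI] at hmem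
      have := hfI ⟨s, hsI⟩
      rw [this, hmem.2, hΓ ⟨s, hsI⟩ (ht.1.trans hs.1)]
    have hft : f t = W (δ t) := heq t ⟨le_rfl, ht.2.le⟩ hsheet.self_of_nhds
    have hWd := hW.hasDerivAt (Metric.mem_ball_self hr) (hpt ▸ hΩ t htc)
    rw [hpt] at hWd
    have hc := (hWd.scomp t (hδ t htc)).hasDerivWithinAt (s := Set.Ici t)
    rw [hft]
    refine hc.congr_of_eventuallyEq ?_ hft
    filter_upwards [self_mem_nhdsWithin, mem_nhdsWithin_of_mem_nhds (Iio_mem_nhds ht.2),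
      mem_nhdsWithin_of_mem_nhds hsheet] with s hs1 hs2 hs3
    exact heq s ⟨hs1, le_of_lt hs2⟩ hs3
  have key := norm_le_gronwallBound_of_norm_deriv_right_le (δ := ‖f t₁‖) (K := K * ℓ) (ε := 0)
    hfc.continuousOn hder le_rfl (fun t ht => ?_) 1 hm1
  · rw [gronwallBound_ε0, hfI] at key
    have h1 : f 1 = (Γ 1).val := hfI 1
    rw [h1] at key
    refine key.trans ?_
    refine mul_le_mul_of_nonneg_left (Real.exp_le_exp.2 ?_) (norm_nonneg _)
    exact mul_le_of_le_one_right (mul_nonneg hK0 hℓ0) (by linarith [t₁.2.1])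
  · have htc : t ∈ Set.Icc (t₁ : ℝ) 1 := Set.Ico_subset_Icc_self ht
    rw [add_zero, norm_smul]
    calc ‖δ' t‖ * ‖S.coef (δ t) (f t)‖ ≤ ℓ * (K * ‖f t‖) := by
          gcongr
          · exact hℓ t htc
          · exact ((S.coef (δ t)).le_opNorm _).trans (by gcongr; exact hK t htc)
      _ = K * ℓ * ‖f t‖ := by ring

theorem Transports.norm_val_le {x y : S.Etale} {γ : I → ℂ} (h : S.Transports x γ y)
    {δ δ' : ℝ → ℂ} {K ℓ : ℝ} (hγ : ∀ t : I, γ t = δ t)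
    (hδ : ∀ t ∈ Set.Icc (0 : ℝ) 1, HasDerivAt δ (δ' t) t)
    (hℓ : ∀ t ∈ Set.Icc (0 : ℝ) 1, ‖δ' t‖ ≤ ℓ)
    (hΩ : ∀ t ∈ Set.Icc (0 : ℝ) 1, δ t ∉ Ω)
    (hK : ∀ t ∈ Set.Icc (0 : ℝ) 1, ‖S.coef (δ t)‖ ≤ K) :
    ‖y.val‖ ≤ ‖x.val‖ * Real.exp (K * ℓ) := by
  obtain ⟨Γ, rfl, rfl, hΓ⟩ := h
  exact norm_val_le_of_lift (t₁ := 0) (fun t _ => (hΓ t).trans (hγ t)) hδ hℓ hΩ hK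

/-- Restrict the lift to `[0, t]`, rescale time, and compare with the lift given by the germ: both
start at the base germ over the same path. -/
theorem val_eq_germ_of_lift {Γ : C(I, S.Etale)} (h0 : Γ 0 = S.base) {t : I}
    (h : ∀ s ≤ t, (Γ s).pt ∈ Metric.ball 0 S.radius) : (Γ t).val = S.germ (Γ t).pt := by
  let φ : C(I, I) := ⟨fun s => t * s, by fun_prop⟩
  have hφ : ∀ s, φ s ≤ t := fun s => unitInterval.mul_le_left
  have hφ0 : φ 0 = 0 := mul_zero t
  have hφ1 : φ 1 = t := mul_one t
  have h1 : S.Transports S.base (fun s => (Γ (φ s)).pt) (Γ t) :=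
    ⟨Γ.comp φ, (congrArg Γ hφ0).trans h0, congrArg Γ hφ1, fun s => rfl⟩
  have hcont : Continuous fun s => (Γ (φ s)).pt :=
    Etale.continuous_pt.comp (Γ.continuous.comp φ.continuous)
  have h2 := Transports.of_mem_leaf hcont S.isLeaf_germ Metric.isOpen_ball
    (fun s => h (φ s) (hφ s))
  have hb : S.isLeaf_germ.point (h (φ 0) (hφ 0)) = S.base := by
    have : (Γ (φ 0)).pt = 0 := by rw [hφ0, h0]; rfl
    exact Etale.ext_iff'.2 ⟨this, congrArg S.germ this⟩
  rw [hb] at h2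
  have h3 := h1.unique h2
  exact (congrArg Etale.val h3).trans (congrArg (fun s => S.germ (Γ s).pt) hφ1)

variable {ν : ℝ} (Δ : SectorialRegion Ω ν)

/-- On the half-radius disc the continuation is the germ, bounded by compactness. Beyond it,
Grönwall's inequality applies along the radius, whose length is less than `Δ.d`. -/
theorem norm_continuation_le_discPart
    (hb : ∀ ν > 0, ∃ K, ∀ z, (∀ a ∈ Ω, ν < dist z a) → ‖S.coef z‖ ≤ K) :
    ∃ C, ∀ q ∈ Δ.discPart, ‖(S.continuation q).val‖ ≤ C := by
  obtain ⟨C, hC⟩ := S.exists_germ_bound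
  have hρ : 0 < S.radius / 2 := half_pos S.radius_pos
  have hC0 : 0 ≤ C := (norm_nonneg _).trans (hC 0 (Metric.mem_closedBall_self hρ.le))
  -- The definition of the region does not keep the disc away from `0` itself. Outside the
  -- half-radius disc the distance to `0` is at least `S.radius / 2`, hence greater than `S.radius /
  -- 4`.
  obtain ⟨K, hK⟩ := hb (min ν (S.radius / 4)) (lt_min Δ.ν_pos (by linarith))
  refine ⟨C * Real.exp (max K 0 * Δ.d), ?_⟩
  rintro q ⟨z, hz, hadm, rfl⟩
  have hzd : ‖z‖ < Δ.d := by simpa using hz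
  obtain ⟨Γ, h0, h1, hΓ⟩ := transports_continuation (S := S) (Path.segment 0 z) hadm
  rw [← h1]
  have hΓ' : ∀ t : I, (Γ t).pt = ((t : ℝ) : ℂ) * z := fun t => by
    rw [hΓ]; simp [AffineMap.lineMap_apply]
  have hnorm : ∀ t : I, ‖(Γ t).pt‖ = t * ‖z‖ := fun t => by
    rw [hΓ', norm_mul, Complex.norm_real, Real.norm_of_nonneg t.2.1]
  have hgerm : ∀ t : I, t * ‖z‖ ≤ S.radius / 2 → ‖(Γ t).val‖ ≤ C := by
    intro t ht
    rw [val_eq_germ_of_lift h0 fun s hs => ?_]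
    · exact hC _ (by simpa [hnorm] using ht)
    · rw [mem_ball_zero_iff, hnorm]
      have : (s : ℝ) * ‖z‖ ≤ t * ‖z‖ := mul_le_mul_of_nonneg_right hs (norm_nonneg _)
      linarith
  rcases le_or_gt ‖z‖ (S.radius / 2) with hzr | hzr
  · refine (hgerm 1 (by simpa using hzr)).trans (le_mul_of_one_le_right hC0 ?_)
    exact Real.one_le_exp (mul_nonneg (le_max_right _ _) Δ.d_pos.le)
  · have hz0 : 0 < ‖z‖ := hρ.trans hzr
    let t₁ : I := ⟨S.radius / 2 / ‖z‖, by positivity, (div_le_one hz0).2 hzr.le⟩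
    have ht₁ : (t₁ : ℝ) * ‖z‖ = S.radius / 2 := div_mul_cancel₀ _ hz0.ne'
    have hfar : ∀ t ∈ Set.Icc (t₁ : ℝ) 1, ∀ a ∈ Ω,
        min ν (S.radius / 4) < dist ((t : ℂ) * z) a := by
      intro t ht a ha
      have ht0 : 0 ≤ t := t₁.2.1.trans ht.1
      have hn : ‖(t : ℂ) * z‖ = t * ‖z‖ := by
        rw [norm_mul, Complex.norm_real, Real.norm_of_nonneg ht0]
      by_cases ha0 : a = 0
      · subst ha0
        rw [dist_zero_right, hn]
        have : (t₁ : ℝ) * ‖z‖ ≤ t * ‖z‖ := mul_le_mul_of_nonneg_right ht.1 (norm_nonneg _)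
        exact (min_le_right _ _).trans_lt (by linarith)
      · refine (min_le_left _ _).trans_lt (Δ.D_dist _ ?_ a ⟨ha, ha0⟩)
        rw [mem_ball_zero_iff, hn]
        exact (mul_le_of_le_one_left (norm_nonneg _) ht.2).trans_lt hzd
    refine (norm_val_le_of_lift (t₁ := t₁) (δ := fun t => (t : ℂ) * z) (δ' := fun _ => z)
      (K := max K 0) (ℓ := Δ.d) (fun t _ => hΓ' t) (fun t _ => ?_) (fun t _ => hzd.le)
      (fun t ht hmem => ?_) (fun t ht => ?_)).trans ?_
    · simpa using (Complex.ofRealCLM.hasDerivAt (x := t)).mul_const z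
    · have := hfar t ht _ hmem
      rw [dist_self] at this
      exact absurd this (lt_min Δ.ν_pos (by linarith)).not_gt
    · exact (hK _ (hfar t ht)).trans (le_max_left _ _)
    · gcongr
      exact hgerm t₁ ht₁.le

/-- One lift of the base path serves all points of the tube. Its values are bounded by compactness,
and the final segment, of length less than `Δ.w`, costs a fixed exponential factor. -/
theorem norm_continuation_le_tubePart
    (hb : ∀ ν > 0, ∃ K, ∀ z, (∀ a ∈ Ω, ν < dist z a) → ‖S.coef z‖ ≤ K) :
    ∃ C, ∀ q ∈ Δ.tubePart, ‖(S.continuation q).val‖ ≤ C := by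
  obtain ⟨K, hK⟩ := hb ν Δ.ν_pos
  obtain ⟨y, hy⟩ := exists_transports (S := S) (Δ.admissible S.zero_mem)
  obtain ⟨m₀, hm₀, Γ, hΓ0, -, hΓ⟩ := Transports.trans_iff.1 hy
  obtain ⟨C, hC⟩ := isCompact_univ.bddAbove_image
    (Etale.continuous_val.comp Γ.continuous).norm.continuousOn
  refine ⟨C * Real.exp (K * Δ.w), ?_⟩
  rintro q ⟨t, z, hz, hadm, rfl⟩
  obtain ⟨m₂, h₂, h₃⟩ := Transports.trans_iff.1 (transports_continuation (S := S) _ hadm)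
  obtain ⟨m₁, h₁, h₂⟩ := Transports.trans_iff.1 h₂
  have e₁ : m₁ = m₀ := by
    refine Transports.unique h₁ ?_
    have : (⇑(Path.segment 0 (Δ.γ 0)) : I → ℂ) = ⇑(Path.segment 0 Δ.p) := by
      ext s; simp
    rw [this]
    exact hm₀
  have e₂ : m₂ = Γ t := by
    refine Transports.unique h₂ ⟨Γ.comp ⟨Set.Icc.convexComb 0 t, by fun_prop⟩, ?_, ?_, fun s => ?_⟩
    · rw [e₁, ← hΓ0]
      exact congrArg Γ (by simp)
    · exact congrArg Γ (by simp)
    · exact hΓ _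
  have hseg : ∀ s ∈ Set.Icc (0 : ℝ) 1,
      (AffineMap.lineMap (Δ.γ t) z s : ℂ) ∈ Metric.ball (Δ.γ t) Δ.w := by
    intro s hs
    have := (convex_ball (Δ.γ t) Δ.w).segment_subset (Metric.mem_ball_self Δ.w_pos) hz
    rw [segment_eq_image_lineMap] at this
    exact this ⟨s, hs, rfl⟩
  refine (h₃.norm_val_le (δ := fun s => AffineMap.lineMap (Δ.γ t) z s)
    (δ' := fun _ => z - Δ.γ t) (K := K) (ℓ := Δ.w) (fun s => rfl) (fun s _ => ?_) (fun s _ => ?_)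
    (fun s hs => Δ.notMem_of_dist (Δ.N_dist t _ (hseg s hs)))
    (fun s hs => hK _ (Δ.N_dist t _ (hseg s hs)))).trans ?_
  · simpa using AffineMap.hasDerivAt_lineMap (a := Δ.γ t) (b := z) (x := s)
  · rw [← dist_eq_norm]
    exact (Metric.mem_ball.1 hz).le
  · rw [e₂]
    gcongr
    exact hC ⟨t, trivial, rfl⟩

/-- The polar segment from `e` to `x` stays in the sector and has speed at most `(1 + (β - α)) (e.1
+ x.1)`. As `x.1` is the modulus of the projection, Grönwall's inequality yields exponential growth;
boundedness of the opening is essential. -/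
theorem norm_continuation_le_sectorPart
    (hb : ∀ ν > 0, ∃ K, ∀ z, (∀ a ∈ Ω, ν < dist z a) → ‖S.coef z‖ ≤ K) :
    ∃ C K, 0 ≤ C ∧ 0 ≤ K ∧ ∀ q ∈ Δ.sectorPart,
      ‖(S.continuation q).val‖ ≤ C * Real.exp (K * ‖q.proj‖) := by
  obtain ⟨K, hK⟩ := hb ν Δ.ν_pos
  have hK0 : 0 ≤ K := (norm_nonneg _).trans (hK _ (Δ.γ_dist 0))
  obtain ⟨y, hy⟩ := exists_transports (S := S) (Δ.admissible S.zero_mem)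
  have he : Δ.e.1 ∈ Set.Ioi Δ.R := Δ.e_mem.1
  have he2 := Δ.e_mem.2
  have he1 : 0 < Δ.e.1 := Δ.R_nonneg.trans_lt he
  have hαβ : 0 < Δ.β - Δ.α := by linarith [he2.1, he2.2]
  refine ⟨‖y.val‖ * Real.exp (K * ((1 + (Δ.β - Δ.α)) * Δ.e.1)), K * (1 + (Δ.β - Δ.α)),
    by positivity, by positivity, ?_⟩
  rintro q ⟨x, hx, hadm, rfl⟩
  have hx1 : 0 < x.1 := Δ.R_nonneg.trans_lt hx.1
  obtain ⟨y', hy', h⟩ := Transports.trans_iff.1 (transports_continuation (S := S) _ hadm)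
  rw [hy'.unique hy] at h
  have hproj : ‖(RSurface.mk _ hadm).proj‖ = x.1 := by
    change ‖polar x‖ = _
    rw [norm_polar, abs_of_pos hx1]
  rw [hproj]
  have hseg : ∀ t ∈ Set.Icc (0 : ℝ) 1,
      (AffineMap.lineMap Δ.e x t : ℝ × ℝ) ∈ Set.Ioi Δ.R ×ˢ Set.Ioo Δ.α Δ.β := by
    intro t ht
    have := ((convex_Ioi (𝕜 := ℝ) Δ.R).prod (convex_Ioo (𝕜 := ℝ) Δ.α Δ.β)).segment_subset Δ.e_mem hx
    rw [segment_eq_image_lineMap] at this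
    exact this ⟨t, ht, rfl⟩
  have hle : ∀ t ∈ Set.Icc (0 : ℝ) 1, (AffineMap.lineMap Δ.e x t : ℝ × ℝ).1 ≤ Δ.e.1 + x.1 := by
    intro t ht
    have e1 : (AffineMap.lineMap Δ.e x t : ℝ × ℝ).1 = (1 - t) * Δ.e.1 + t * x.1 := by
      simp [AffineMap.lineMap_apply]; ring
    rw [e1]
    nlinarith [ht.1, ht.2]
  refine (h.norm_val_le (δ := fun t => polar (AffineMap.lineMap Δ.e x t)) (K := K)
    (ℓ := (1 + (Δ.β - Δ.α)) * (Δ.e.1 + x.1)) (fun t => rfl)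
    (fun t _ => hasDerivAt_polar_lineMap Δ.e x t) (fun t ht => ?_)
    (fun t ht => Δ.notMem_of_dist (Δ.S_dist _ (hseg t ht)))
    (fun t ht => hK _ (Δ.S_dist _ (hseg t ht)))).trans (le_of_eq ?_)
  · rw [norm_mul, Complex.norm_exp_ofReal_mul_I, mul_one]
    have hρ : 0 ≤ (AffineMap.lineMap Δ.e x t : ℝ × ℝ).1 := Δ.R_nonneg.trans (hseg t ht).1.le
    calc ‖((x.1 - Δ.e.1 : ℝ) : ℂ) +
          (((AffineMap.lineMap Δ.e x t : ℝ × ℝ).1 * (x.2 - Δ.e.2) : ℝ) : ℂ) * Complex.I‖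
        ≤ |x.1 - Δ.e.1| + (AffineMap.lineMap Δ.e x t : ℝ × ℝ).1 * |x.2 - Δ.e.2| := by
          refine (norm_add_le _ _).trans ?_
          rw [norm_mul, Complex.norm_I, mul_one, Complex.norm_real, Complex.norm_real,
            Real.norm_eq_abs, Real.norm_eq_abs, abs_mul, abs_of_nonneg hρ]
      _ ≤ (Δ.e.1 + x.1) + (Δ.e.1 + x.1) * (Δ.β - Δ.α) := by
          gcongr
          · rw [abs_le]; constructor <;> linarith
          · exact hle t ht
          · rw [abs_le]; constructor <;> linarith [he2.1, he2.2, hx.2.1, hx.2.2]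
      _ = _ := by ring
  · rw [mul_assoc, ← Real.exp_add]
    congr 2
    ring

/-- At most exponential growth of the continuation on sectorial regions. -/
theorem exists_growth_bound
    (hb : ∀ ν > 0, ∃ K, ∀ z, (∀ a ∈ Ω, ν < dist z a) → ‖S.coef z‖ ≤ K) :
    ∃ C K : ℝ, ∀ q ∈ Δ.carrier, ‖(S.continuation q).val‖ ≤ C * Real.exp (K * ‖q.proj‖) := by
  obtain ⟨C₁, h₁⟩ := norm_continuation_le_discPart Δ hb
  obtain ⟨C₂, h₂⟩ := norm_continuation_le_tubePart Δ hb
  obtain ⟨C₃, K, hC₃, hK, h₃⟩ := norm_continuation_le_sectorPart Δ hb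
  have hM : 0 ≤ max (max C₁ C₂) C₃ := hC₃.trans (le_max_right _ _)
  refine ⟨max (max C₁ C₂) C₃, K, ?_⟩
  have hexp : ∀ q : RSurface Ω, 1 ≤ Real.exp (K * ‖q.proj‖) := fun q =>
    Real.one_le_exp (by positivity)
  rintro q ((hq | hq) | hq)
  · exact ((h₁ q hq).trans ((le_max_left _ _).trans (le_max_left _ _))).trans
      (le_mul_of_one_le_right hM (hexp q))
  · exact ((h₂ q hq).trans ((le_max_right _ _).trans (le_max_left _ _))).trans
      (le_mul_of_one_le_right hM (hexp q))
  · refine (h₃ q hq).trans ?_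
    gcongr
    exact le_max_right _ _

/-- The continuation of the germ, composed with a linear form, is summable-resurgent. -/
theorem isSummableResurgentFunction
    (hb : ∀ ν > 0, ∃ K, ∀ z, (∀ a ∈ Ω, ν < dist z a) → ‖S.coef z‖ ≤ K) (L : E →L[ℂ] ℂ) :
    IsSummableResurgentFunction fun q : RSurface Ω => L (S.continuation q).val := by
  refine ⟨isAnalytic_continuation L, fun ν Δ => ?_⟩
  obtain ⟨C, K, h⟩ := exists_growth_bound (S := S) Δ hb
  refine ⟨‖L‖ * C, K, fun q hq => ?_⟩
  rw [mul_assoc]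
  exact (L.le_opNorm _).trans (by gcongr; exact h q hq)

end SingularConnection

/-! ### The differential equation in the Borel plane -/

section Recurrence

variable {ι : Type*} [Fintype ι] {a : ι → ℂ} {b : ℕ → ι → ι → ℂ} {y : ℕ → ι → ℂ} {M s : ℝ}

theorem norm_sum_mul_le (hb : ∀ l i j, ‖b l i j‖ ≤ M * s ^ l) (l m : ℕ) (i : ι) :
    ‖∑ j, b l i j * y m j‖ ≤ Fintype.card ι * M * s ^ l * ‖y m‖ := by
  calc ‖∑ j, b l i j * y m j‖ ≤ ∑ _j : ι, M * s ^ l * ‖y m‖ := by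
        refine norm_sum_le_of_le _ fun j _ => ?_
        rw [norm_mul]
        exact mul_le_mul (hb l i j) (norm_le_pi_norm (y m) j) (norm_nonneg _)
          ((norm_nonneg _).trans (hb l i j))
    _ = _ := by
        rw [Finset.sum_const, Finset.card_univ, nsmul_eq_mul]; ring

/-- The coefficients of a formal solution, compared with those of smaller index. -/
theorem exists_norm_succ_le (hs : 0 < s) (hM : 0 ≤ M) (hb : ∀ l i j, ‖b l i j‖ ≤ M * s ^ l)
    (hrec : ∀ (m : ℕ) i, (m : ℂ) * y m i =
      a i * y (m + 1) i + ∑ l ∈ Finset.range (m + 1), ∑ j, b (l + 1) i j * y (m - l) j) :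
    ∃ c : ℝ, 0 < c ∧ ∃ m₀ : ℕ, ∀ m ≥ m₀, ‖y (m + 1)‖ ≤
      c * (m * ‖y m‖ + ∑ l ∈ Finset.range (m + 1), s ^ l * ‖y (m - l)‖) := by
  set M' : ℝ := Fintype.card ι * M * s with hM'
  have hM'0 : 0 ≤ M' := by positivity
  -- Indices with `a i = 0` contribute nothing, since the inverse of zero is zero.
  set d : ℝ := ∑ i, ‖a i‖⁻¹ with hd
  have hd0 : 0 ≤ d := Finset.sum_nonneg fun i _ => by positivity
  set c : ℝ := d * (1 + M') + M' * s + 1 with hc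
  have hc1 : d ≤ c := by nlinarith [mul_nonneg hM'0 hs.le, mul_nonneg hd0 hM'0]
  have hc2 : d * M' ≤ c := by nlinarith [mul_nonneg hM'0 hs.le, mul_nonneg hd0 hM'0]
  have hc3 : M' * s ≤ c := by nlinarith [mul_nonneg hd0 hM'0]
  have hc0 : 0 < c := by positivity
  -- Beyond this index, the term in `y (m + 1)` that occurs on the right when `a i = 0` is at most
  -- half of `‖y (m + 1)‖` after division by `m + 1`, and can be absorbed.
  obtain ⟨m₀, hm₀⟩ := exists_nat_ge (2 * M')
  refine ⟨2 * c, by positivity, m₀, fun m hm => ?_⟩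
  set Q : ℝ := ∑ l ∈ Finset.range (m + 1), s ^ l * ‖y (m - l)‖ with hQ
  have hQ0 : 0 ≤ Q := Finset.sum_nonneg fun l _ => by positivity
  have hmN : 0 ≤ m * ‖y m‖ := by positivity
  have key : ∀ i, ‖y (m + 1) i‖ ≤ ‖y (m + 1)‖ / 2 + c * (m * ‖y m‖ + Q) := by
    intro i
    by_cases hai : a i = 0
    -- When `a i = 0` the relation at index `m` no longer determines `y (m + 1) i`. The next one
    -- does, through its left-hand side.
    · have h := hrec (m + 1) i
      rw [hai, zero_mul, zero_add, Finset.sum_range_succ'] at h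
      have h2 : ‖∑ l ∈ Finset.range (m + 1), ∑ j, b (l + 1 + 1) i j * y (m + 1 - (l + 1)) j‖ ≤
          M' * s * Q := by
        rw [hQ, Finset.mul_sum]
        refine norm_sum_le_of_le _ fun l _ => (norm_sum_mul_le hb _ _ _).trans (le_of_eq ?_)
        rw [Nat.add_sub_add_right, hM']
        ring
      have h3 : ‖∑ j, b (0 + 1) i j * y (m + 1 - 0) j‖ ≤ M' * ‖y (m + 1)‖ := by
        refine (norm_sum_mul_le hb _ _ _).trans (le_of_eq ?_)
        rw [hM']
        simp
      have h4 : ((m : ℝ) + 1) * ‖y (m + 1) i‖ ≤ M' * s * Q + M' * ‖y (m + 1)‖ := by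
        have h5 := congrArg norm h
        rw [norm_mul, Complex.norm_natCast, Nat.cast_succ] at h5
        rw [h5]
        exact (norm_add_le _ _).trans (add_le_add h2 h3)
      have hmm : 2 * M' ≤ (m : ℝ) + 1 := by
        have : (m₀ : ℝ) ≤ m := by exact_mod_cast hm
        linarith
      have hpos : (0 : ℝ) < m + 1 := by positivity
      have h6 : M' * ‖y (m + 1)‖ ≤ (m + 1) * (‖y (m + 1)‖ / 2) := by
        nlinarith [norm_nonneg (y (m + 1))]
      have h7 : M' * s * Q ≤ (m + 1) * (c * (m * ‖y m‖ + Q)) := by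
        calc M' * s * Q ≤ c * (m * ‖y m‖ + Q) := by
              gcongr; linarith
          _ ≤ _ := le_mul_of_one_le_left (by positivity) (by linarith [m.cast_nonneg (α := ℝ)])
      refine le_of_mul_le_mul_left (a := (m : ℝ) + 1) ?_ hpos
      linarith
    · have h := hrec m i
      have hd' : ‖a i‖⁻¹ ≤ d :=
        Finset.single_le_sum (f := fun i => ‖a i‖⁻¹) (fun i _ => by positivity) (Finset.mem_univ i)
      have h2 : ‖∑ l ∈ Finset.range (m + 1), ∑ j, b (l + 1) i j * y (m - l) j‖ ≤ M' * Q := by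
        rw [hQ, Finset.mul_sum]
        refine norm_sum_le_of_le _ fun l _ => (norm_sum_mul_le hb _ _ _).trans (le_of_eq ?_)
        rw [hM']
        ring
      have h3 : y (m + 1) i = (a i)⁻¹ * (m * y m i -
          ∑ l ∈ Finset.range (m + 1), ∑ j, b (l + 1) i j * y (m - l) j) := by
        rw [h, add_sub_cancel_right, inv_mul_cancel_left₀ hai]
      rw [h3, norm_mul, norm_inv]
      calc ‖a i‖⁻¹ * ‖(m : ℂ) * y m i -
            ∑ l ∈ Finset.range (m + 1), ∑ j, b (l + 1) i j * y (m - l) j‖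
          ≤ d * (m * ‖y m‖ + M' * Q) := by
            gcongr
            refine (norm_sub_le _ _).trans (add_le_add ?_ h2)
            rw [norm_mul, Complex.norm_natCast]
            gcongr
            exact norm_le_pi_norm (y m) i
        _ = d * (m * ‖y m‖) + d * M' * Q := by ring
        _ ≤ c * (m * ‖y m‖) + c * Q := by gcongr
        _ = 0 + c * (m * ‖y m‖ + Q) := by ring
        _ ≤ _ := by gcongr; positivity
  have := (pi_norm_le_iff_of_nonneg (by positivity)).2 key
  linarith

/-- The formal solutions are of Gevrey order one. -/
theorem exists_gevrey_bound (hs : 0 < s) {c : ℝ} (hc : 0 < c) {m₀ : ℕ} {N : ℕ → ℝ}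
    (hN : ∀ m, 0 ≤ N m) (h : ∀ m ≥ m₀, N (m + 1) ≤
      c * (m * N m + ∑ l ∈ Finset.range (m + 1), s ^ l * N (m - l))) :
    ∃ C K : ℝ, 0 ≤ C ∧ 0 < K ∧ ∀ m, N m ≤ C * K ^ m * m.factorial := by
  -- The bound `1` covers the initial terms, `2 * s` makes the convolution a geometric sum of ratio
  -- `1/2`, and `2 * c` gives `c (m + 2) ≤ K (m + 1)`, where `m + 1` feeds the factorial.
  set K : ℝ := max 1 (max (2 * s) (2 * c)) with hK
  have hK1 : 1 ≤ K := le_max_left _ _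
  have hKs : 2 * s ≤ K := (le_max_left _ _).trans (le_max_right _ _)
  have hKc : 2 * c ≤ K := (le_max_right _ _).trans (le_max_right _ _)
  have hK0 : 0 < K := by linarith
  set C : ℝ := ∑ m ∈ Finset.range (m₀ + 1), N m with hC
  have hC0 : 0 ≤ C := Finset.sum_nonneg fun m _ => hN m
  refine ⟨C, K, hC0, hK0, fun m => ?_⟩
  induction m using Nat.strong_induction_on with
  | _ m ih =>
    rcases le_or_gt m m₀ with hm | hm
    · have h1 : N m ≤ C := Finset.single_le_sum (fun m _ => hN m)
        (Finset.mem_range.2 (Nat.lt_succ_of_le hm))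
      have h2 : 1 ≤ K ^ m := one_le_pow₀ hK1
      have h3 : (1 : ℝ) ≤ m.factorial := by exact_mod_cast m.factorial_pos
      calc N m ≤ C * 1 * 1 := by linarith
        _ ≤ _ := by gcongr
    obtain ⟨m, rfl⟩ : ∃ m', m = m' + 1 := ⟨m - 1, by omega⟩
    have hsum : ∑ l ∈ Finset.range (m + 1), s ^ l * N (m - l) ≤ 2 * (C * K ^ m * m.factorial) := by
      calc ∑ l ∈ Finset.range (m + 1), s ^ l * N (m - l)
          ≤ ∑ l ∈ Finset.range (m + 1), (C * K ^ m * m.factorial) * (1 / 2) ^ l := by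
            refine Finset.sum_le_sum fun l hl => ?_
            have hl' : l ≤ m := Nat.lt_succ_iff.1 (Finset.mem_range.1 hl)
            have hf : ((m - l).factorial : ℝ) ≤ m.factorial := by
              exact_mod_cast Nat.factorial_le (Nat.sub_le m l)
            calc s ^ l * N (m - l)
                ≤ (K / 2) ^ l * (C * K ^ (m - l) * (m - l).factorial) := by
                  gcongr
                  · exact hN _
                  · linarith
                  · exact ih (m - l) (by omega)
              _ ≤ (K / 2) ^ l * (C * K ^ (m - l) * m.factorial) := by gcongr
              _ = C * (K ^ (m - l) * K ^ l) * m.factorial * (1 / 2) ^ l := by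
                  rw [div_eq_mul_one_div, mul_pow]; ring
              _ = _ := by rw [← pow_add, Nat.sub_add_cancel hl']
        _ ≤ (C * K ^ m * m.factorial) * 2 := by
            rw [← Finset.mul_sum]
            gcongr
            have := Summable.sum_le_tsum (Finset.range (m + 1)) (fun _ _ => by positivity)
              summable_geometric_two
            rwa [tsum_geometric_two] at this
        _ = _ := by ring
    calc N (m + 1) ≤ c * (m * N m + ∑ l ∈ Finset.range (m + 1), s ^ l * N (m - l)) :=
          h m (by omega)
      _ ≤ c * (m * (C * K ^ m * m.factorial) + 2 * (C * K ^ m * m.factorial)) := by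
          gcongr
          exact ih m (Nat.lt_succ_self m)
      _ = C * K ^ m * m.factorial * (c * (m + 2)) := by ring
      _ ≤ C * K ^ m * m.factorial * (K * (m + 1)) := by
          gcongr ?_ * ?_
          nlinarith [m.cast_nonneg (α := ℝ), mul_nonneg hc.le (m.cast_nonneg (α := ℝ))]
      _ = C * K ^ (m + 1) * (m + 1).factorial := by
          rw [Nat.factorial_succ]; push_cast; ring

end Recurrence

/-- The Banach space in which the iterated primitives of the Borel transform live. -/
abbrev PrimitiveSpace (ι : Type*) : Type _ := lp (fun _ : ℕ × ι => ℂ) ⊤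

/-! ### Bounded families, the weighted shift and summable linear forms. -/

namespace PrimitiveSpace

variable {ι : Type*}

theorem norm_apply_le (w : PrimitiveSpace ι) (x : ℕ × ι) : ‖w x‖ ≤ ‖w‖ :=
  lp.norm_apply_le_norm (by simp) w x

/-- A bounded family, as an element of the Banach space. -/
def ofBound (f : ℕ × ι → ℂ) (C : ℝ) (h : ∀ x, ‖f x‖ ≤ C) : PrimitiveSpace ι :=
  ⟨f, memℓp_infty ⟨C, by rintro _ ⟨x, rfl⟩; exact h x⟩⟩

theorem ofBound_apply (f : ℕ × ι → ℂ) (C : ℝ) (h : ∀ x, ‖f x‖ ≤ C) (x : ℕ × ι) :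
    ofBound f C h x = f x := rfl

theorem norm_ofBound_le (f : ℕ × ι → ℂ) (C : ℝ) (hC : 0 ≤ C) (h : ∀ x, ‖f x‖ ≤ C) :
    ‖ofBound f C h‖ ≤ C :=
  lp.norm_le_of_forall_le hC h

/-- The values of the weighted shift. -/
def shiftFun (κ : ℝ) (w : ℕ × ι → ℂ) : ℕ × ι → ℂ
  | (0, _) => 0
  | (l + 1, i) => κ * w (l, i)

theorem norm_shiftFun_le (κ : ℝ) (w : PrimitiveSpace ι) (x : ℕ × ι) :
    ‖shiftFun κ w x‖ ≤ |κ| * ‖w‖ := by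
  rcases x with ⟨_ | l, i⟩
  · simp only [shiftFun, norm_zero]; positivity
  · simp only [shiftFun, norm_mul, Complex.norm_real, Real.norm_eq_abs]
    gcongr
    exact norm_apply_le w _

/-- The weighted shift. -/
def shift (κ : ℝ) : PrimitiveSpace ι →L[ℂ] PrimitiveSpace ι :=
  LinearMap.mkContinuous
    { toFun := fun w => ofBound (shiftFun κ w) _ (norm_shiftFun_le κ w)
      map_add' := fun v w => by
        ext ⟨_ | l, i⟩ <;> simp [ofBound_apply, shiftFun, mul_add]
      map_smul' := fun c w => by
        ext ⟨_ | l, i⟩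
        · simp [ofBound_apply, shiftFun]
        · simp [ofBound_apply, shiftFun]; ring }
    |κ| (fun w => norm_ofBound_le _ _ (by positivity) (norm_shiftFun_le κ w))

theorem shift_zero (κ : ℝ) (w : PrimitiveSpace ι) (i : ι) : shift κ w (0, i) = 0 := rfl

theorem shift_succ (κ : ℝ) (w : PrimitiveSpace ι) (l : ℕ) (i : ι) :
    shift κ w (l + 1, i) = κ * w (l, i) := rfl

variable [Fintype ι]

theorem summable_row {β : ℕ → ι → ℂ} (hβ : ∀ j, Summable fun l => ‖β l j‖) (w : PrimitiveSpace ι) :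
    Summable fun l => ∑ j, β l j * w (l, j) := by
  refine summable_sum fun j _ => Summable.of_norm_bounded ((hβ j).mul_right ‖w‖) fun l => ?_
  rw [norm_mul]
  gcongr
  exact norm_apply_le w _

/-- The continuous linear form `w ↦ ∑ β_{l,j} w_{l,j}`, when `β` is summable. -/
def row (β : ℕ → ι → ℂ) (hβ : ∀ j, Summable fun l => ‖β l j‖) : PrimitiveSpace ι →L[ℂ] ℂ :=
  LinearMap.mkContinuous
    { toFun := fun w => ∑' l, ∑ j, β l j * w (l, j)
      map_add' := fun v w => by
        rw [← (summable_row hβ v).tsum_add (summable_row hβ w)]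
        refine tsum_congr fun l => ?_
        rw [← Finset.sum_add_distrib]
        exact Finset.sum_congr rfl fun j _ => by simp [mul_add]
      map_smul' := fun c w => by
        rw [RingHom.id_apply, smul_eq_mul, ← tsum_mul_left]
        refine tsum_congr fun l => ?_
        rw [Finset.mul_sum]
        exact Finset.sum_congr rfl fun j _ => by simp; ring }
    (∑' l, ∑ j, ‖β l j‖) (fun w => by
      have hs : Summable fun l => ∑ j, ‖β l j‖ := summable_sum fun j _ => hβ j
      rw [← tsum_mul_right]
      refine tsum_of_norm_bounded (hs.mul_right ‖w‖).hasSum fun l => ?_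
      rw [Finset.sum_mul]
      refine norm_sum_le_of_le _ fun j _ => ?_
      rw [norm_mul]
      gcongr
      exact norm_apply_le w _)

theorem row_apply (β : ℕ → ι → ℂ) (hβ : ∀ j, Summable fun l => ‖β l j‖) (w : PrimitiveSpace ι) :
    row β hβ w = ∑' l, ∑ j, β l j * w (l, j) := rfl

end PrimitiveSpace

/-! ### Formal solutions in the Borel plane -/

section BorelPlane

open PrimitiveSpace

variable {ι : Type*} [Fintype ι]

/-- The Taylor coefficients of the iterated primitives of the Borel transform of `∑ yₘ xᵐ`. -/
def borelCoeffFun (y : ℕ → ι → ℂ) (κ : ℝ) (k : ℕ) (x : ℕ × ι) : ℂ :=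
  -- Level `l = x.1` is the Borel transform of `κ^l x^l y`. The case `l = k + 1` retains the
  -- constant term `y 0`, whose Dirac mass becomes a function after one integration.
  if x.1 ≤ k + 1 then (κ : ℂ) ^ x.1 * (y (k + 1 - x.1) x.2 / k.factorial) else 0

/-- The powers of `κ` and `K` have total exponent `k + 1`, and `(k + 1 - l)! ≤ (k + 1)! ≤ 2^k k!`.
The bound is thus uniform in the level, so the Taylor series converges in the Banach space itself.
-/
theorem norm_borelCoeffFun_le {y : ℕ → ι → ℂ} {κ C K T : ℝ} (hC : 0 ≤ C) (hK : 0 < K)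
    (hκ : 0 < κ) (hκT : κ ≤ T) (hKT : K ≤ T) (hy : ∀ m, ‖y m‖ ≤ C * K ^ m * m.factorial)
    (k : ℕ) (x : ℕ × ι) : ‖borelCoeffFun y κ k x‖ ≤ C * T * (2 * T) ^ k := by
  have hT : 0 < T := hκ.trans_le hκT
  rw [borelCoeffFun]
  split_ifs with h
  swap
  · rw [norm_zero]; positivity
  have hk : (0 : ℝ) < k.factorial := by exact_mod_cast k.factorial_pos
  have hf : ((k + 1 - x.1).factorial : ℝ) ≤ 2 ^ k * k.factorial := by
    have h1 : (k + 1 - x.1).factorial ≤ (k + 1).factorial := Nat.factorial_le (Nat.sub_le _ _)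
    have h2 : (k + 1).factorial ≤ 2 ^ k * k.factorial := by
      rw [Nat.factorial_succ]
      exact Nat.mul_le_mul_right _ (Nat.lt_two_pow_self)
    exact_mod_cast h1.trans h2
  rw [norm_mul, norm_div, norm_pow, Complex.norm_real, Real.norm_of_nonneg hκ.le,
    Complex.norm_natCast]
  have h1 : ‖y (k + 1 - x.1) x.2‖ ≤ C * T ^ (k + 1 - x.1) * (2 ^ k * k.factorial) := by
    refine (norm_le_pi_norm _ x.2).trans ((hy _).trans ?_)
    gcongr
  calc κ ^ x.1 * (‖y (k + 1 - x.1) x.2‖ / k.factorial)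
      ≤ T ^ x.1 * (C * T ^ (k + 1 - x.1) * (2 ^ k * k.factorial) / k.factorial) := by
        gcongr
    _ = C * (T ^ (k + 1 - x.1) * T ^ x.1) * 2 ^ k := by field_simp
    _ = C * T * (2 * T) ^ k := by
        rw [← pow_add, Nat.sub_add_cancel h, pow_succ, mul_pow]; ring

variable [DecidableEq ι] {a : ι → ℂ} {b : ℕ → ι → ι → ℂ} {y : ℕ → ι → ℂ}

/-- A formal solution of `x² Y' = B(x) Y`, where `B` converges and `B(0)` is diagonal, is
summable-resurgent. -/
theorem isSummableResurgent_of_recurrence {M s : ℝ} (h0 : (0 : ℂ) ∈ Set.range a)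
    (hs : 0 < s) (hM : 0 ≤ M) (hb : ∀ l i j, ‖b l i j‖ ≤ M * s ^ l)
    (hrec : ∀ (m : ℕ) i, (m : ℂ) * y m i =
      a i * y (m + 1) i + ∑ l ∈ Finset.range (m + 1), ∑ j, b (l + 1) i j * y (m - l) j)
    (i₀ : ι) (f : ℂ⟦X⟧) (hf : ∀ m, PowerSeries.coeff m f = y m i₀) :
    IsSummableResurgent (Set.range a) f := by
  obtain ⟨c, hc, m₀, hN⟩ := exists_norm_succ_le hs hM hb hrec
  obtain ⟨C, K, hC, hK, hy⟩ := exists_gevrey_bound hs hc (fun m => norm_nonneg (y m)) hN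
  -- With this weight the coefficients of the linear forms below decay like `2⁻ˡ`.
  set κ : ℝ := 2 * s with hκ
  have hκ0 : 0 < κ := by positivity
  set T : ℝ := max κ K with hT
  have hT0 : 0 < T := lt_max_of_lt_left hκ0
  have hbd := norm_borelCoeffFun_le hC hK hκ0 (le_max_left κ K) (le_max_right κ K) hy
  let e : ℕ → PrimitiveSpace ι := fun k => ofBound (borelCoeffFun y κ k) _ (hbd k)
  have he : ∀ k, ‖e k‖ ≤ C * T * (2 * T) ^ k := fun k =>
    norm_ofBound_le _ _ (by positivity) (hbd k)
  have hβ : ∀ i j, Summable fun l => ‖b (l + 1) i j * ((κ : ℂ) ^ l)⁻¹‖ := fun i j => by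
    refine Summable.of_nonneg_of_le (fun _ => norm_nonneg _) (fun l => ?_)
      (summable_geometric_two.mul_left (M * s))
    rw [norm_mul, norm_inv, norm_pow, Complex.norm_real, Real.norm_of_nonneg hκ0.le]
    calc ‖b (l + 1) i j‖ * (κ ^ l)⁻¹ ≤ M * s ^ (l + 1) * (κ ^ l)⁻¹ := by gcongr; exact hb _ _ _
      _ = M * s * (1 / 2) ^ l := by
        rw [hκ, mul_pow, one_div, inv_pow]; field_simp; ring
  -- Differentiating `(z - a i) w_{0,i} = ∑ b_{l+1} κ^{-(l+1)} w_{l+1}` gives `(z - a i) w_{0,i}' =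
  -- φ i w`; the subtracted evaluation comes from the derivative of `z - a i`.
  let φ : ι → PrimitiveSpace ι →L[ℂ] ℂ := fun i =>
    row (fun l j => b (l + 1) i j * ((κ : ℂ) ^ l)⁻¹) (hβ i) - lp.evalCLM ℂ _ ⊤ (0, i)
  let R : ι → PrimitiveSpace ι →L[ℂ] PrimitiveSpace ι := fun i =>
    (φ i).smulRight (lp.single ⊤ ((0, i) : ℕ × ι) (1 : ℂ))
  let coef : ℂ → PrimitiveSpace ι →L[ℂ] PrimitiveSpace ι := fun z =>
    shift κ + ∑ i, (z - a i)⁻¹ • R i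
  let germ : ℂ → PrimitiveSpace ι := fun z => ∑' k, z ^ k • e k
  have hcoef_succ : ∀ z w l i, coef z w (l + 1, i) = κ * w (l, i) := by
    intro z w l i
    simp only [coef, R, add_apply, sum_apply,
      smul_apply, ContinuousLinearMap.smulRight_apply, lp.coeFn_add,
      Pi.add_apply, lp.coeFn_sum, Finset.sum_apply, lp.coeFn_smul, Pi.smul_apply, shift_succ]
    rw [Finset.sum_eq_zero, add_zero]
    intro j _
    rw [lp.single_apply_ne _ _ _ (by simp), smul_zero, smul_zero]
  have hcoef_zero : ∀ z w i, coef z w (0, i) = (z - a i)⁻¹ * φ i w := by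
    intro z w i
    simp only [coef, R, add_apply, sum_apply,
      smul_apply, ContinuousLinearMap.smulRight_apply, lp.coeFn_add,
      Pi.add_apply, lp.coeFn_sum, Finset.sum_apply, lp.coeFn_smul, Pi.smul_apply, shift_zero]
    rw [Finset.sum_eq_single i, lp.single_apply_self, zero_add]
    · simp
    · intro j _ hj
      rw [lp.single_apply_ne _ _ _ (by simpa using hj.symm), smul_zero, smul_zero]
    · simp
  have hφe : ∀ i k, φ i (e k) = (k * y (k + 1) i - a i * y (k + 2) i) / k.factorial := by
    intro i k
    have h1 : row (fun l j => b (l + 1) i j * ((κ : ℂ) ^ l)⁻¹) (hβ i) (e k) =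
        ∑ l ∈ Finset.range (k + 2), ∑ j, b (l + 1) i j * y (k + 1 - l) j / k.factorial := by
      rw [row_apply, tsum_eq_sum (s := Finset.range (k + 2))]
      · refine Finset.sum_congr rfl fun l hl => Finset.sum_congr rfl fun j _ => ?_
        have hl' : l ≤ k + 1 := Nat.lt_succ_iff.1 (Finset.mem_range.1 hl)
        have hκl : (κ : ℂ) ^ l ≠ 0 := pow_ne_zero _ (by exact_mod_cast hκ0.ne')
        simp only [e, ofBound_apply, borelCoeffFun, if_pos hl']
        field_simp
      · intro l hl
        have hl' : ¬ l ≤ k + 1 := fun h => hl (Finset.mem_range.2 (Nat.lt_succ_of_le h))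
        exact Finset.sum_eq_zero fun j _ => by
          simp only [e, ofBound_apply, borelCoeffFun, if_neg hl', mul_zero]
    have h2 : lp.evalCLM ℂ (fun _ : ℕ × ι => ℂ) ⊤ (0, i) (e k) = y (k + 1) i / k.factorial := by
      change borelCoeffFun y κ k (0, i) = _
      simp [borelCoeffFun]
    have h3 := hrec (k + 1) i
    change row _ _ (e k) - lp.evalCLM ℂ (fun _ : ℕ × ι => ℂ) ⊤ (0, i) (e k) = _
    rw [h1, h2]
    simp only [← Finset.sum_div]
    rw [← sub_div]
    congr 1
    push_cast at h3
    linear_combination -h3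
  obtain ⟨r₁, hr₁, hball⟩ : ∃ r > 0, ∀ z ∈ Metric.ball (0 : ℂ) r, z ∈ Set.range a → z = 0 := by
    have hfin : (Set.range a \ {0}).Finite := (Set.finite_range a).sdiff
    obtain ⟨r, hr, h⟩ := Metric.isOpen_iff.1 hfin.isClosed.isOpen_compl 0 (by simp)
    exact ⟨r, hr, fun z hz hza => by
      by_contra hne
      exact h hz ⟨hza, hne⟩⟩
  have hsmall : ∀ z ∈ Metric.ball (0 : ℂ) (min r₁ (2 * T)⁻¹), ‖z‖ * (2 * T) < 1 := by
    intro z hz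
    have h1 : ‖z‖ < (2 * T)⁻¹ :=
      mem_ball_zero_iff.1 (Metric.ball_subset_ball (min_le_right _ _) hz)
    exact (lt_inv_mul_iff₀' (by positivity)).1 (by simpa using h1)
  have hgerm : ∀ z, ‖z‖ * (2 * T) < 1 → HasSum (fun k => z ^ k • e k) (germ z) := fun z hz =>
    (summable_norm_pow_smul (by positivity) he hz).of_norm.hasSum
  have hderiv : ∀ z ∈ Metric.ball (0 : ℂ) (min r₁ (2 * T)⁻¹), z ≠ 0 →
      HasDerivAt germ (coef z (germ z)) z := by
    intro z hz hz0
    have hz1 := hsmall z hz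
    have hd := hasDerivAt_tsum_pow_smul (by positivity) he hz1
    have hd' : Summable fun k : ℕ => z ^ k • ((k + 1 : ℂ) • e (k + 1)) :=
      summable_pow_smul_succ (by positivity) he hz1
    suffices h : coef z (germ z) = ∑' k : ℕ, z ^ k • ((k + 1 : ℂ) • e (k + 1)) by
      rw [h]
      exact hd
    refine lp.ext (funext fun ⟨l, i⟩ => ?_)
    have hD := (lp.evalCLM ℂ (fun _ : ℕ × ι => ℂ) ⊤ (l, i)).hasSum hd'.hasSum
    change HasSum (fun k : ℕ => z ^ k * ((k + 1 : ℂ) * borelCoeffFun y κ (k + 1) (l, i)))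
      ((∑' k : ℕ, z ^ k • ((k + 1 : ℂ) • e (k + 1))) (l, i)) at hD
    rcases l with _ | l
    · rw [hcoef_zero]
      have hne : z - a i ≠ 0 := fun h => hz0 (hball z
        (Metric.ball_subset_ball (min_le_left _ _) hz) ⟨i, (sub_eq_zero.1 h).symm⟩)
      rw [inv_mul_eq_iff_eq_mul₀ hne]
      have hφ := (φ i).hasSum (hgerm z hz1)
      refine hφ.unique ?_
      -- Multiplying the derivative by `z` shifts the index by one; the new term at `k = 0` vanishes
      -- because of the factor `k`.
      have hD1 : HasSum (fun k : ℕ => z ^ k * (k * (y (k + 1) i / k.factorial)))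
          (z * (∑' k : ℕ, z ^ k • ((k + 1 : ℂ) • e (k + 1))) (0, i)) := by
        rw [← hasSum_nat_add_iff' 1]
        simp only [Finset.range_one, Finset.sum_singleton, Nat.cast_zero, zero_mul, mul_zero,
          sub_zero]
        refine HasSum.congr_fun (hD.mul_left z) fun k => ?_
        simp [borelCoeffFun]
        ring
      have := hD1.sub (hD.mul_left (a i))
      rw [← sub_mul] at this
      refine HasSum.congr_fun this fun k => ?_
      simp only [map_smul, hφe, smul_eq_mul, borelCoeffFun, zero_le, if_true,
        pow_zero, one_mul, Nat.sub_zero, Nat.factorial_succ]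
      have hk : ((k : ℂ) + 1) ≠ 0 := by exact_mod_cast k.succ_ne_zero
      have hk' : (k.factorial : ℂ) ≠ 0 := by exact_mod_cast k.factorial_ne_zero
      push_cast
      field_simp
    · rw [hcoef_succ]
      have hg := (lp.evalCLM ℂ (fun _ : ℕ × ι => ℂ) ⊤ (l, i)).hasSum (hgerm z hz1)
      change HasSum (fun k : ℕ => z ^ k * borelCoeffFun y κ k (l, i)) (germ z (l, i)) at hg
      refine (hg.mul_left (κ : ℂ)).unique (HasSum.congr_fun hD fun k => ?_)
      simp only [borelCoeffFun, Nat.add_le_add_iff_right, Nat.add_sub_add_right,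
        Nat.factorial_succ]
      split_ifs
      · have hk : ((k : ℂ) + 1) ≠ 0 := by exact_mod_cast k.succ_ne_zero
        have hk' : (k.factorial : ℂ) ≠ 0 := by exact_mod_cast k.factorial_ne_zero
        push_cast
        field_simp
        ring
      · simp
  let S : SingularConnection (Set.range a) (PrimitiveSpace ι) :=
    { zero_mem := h0
      isClosed := (Set.finite_range a).isClosed
      coef := coef
      coef_analyticAt := fun z hz => by
        refine analyticAt_const.add (Finset.analyticAt_fun_sum _ fun i _ => ?_)
        refine AnalyticAt.smul (AnalyticAt.inv (analyticAt_id.sub analyticAt_const) fun h => ?_)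
          analyticAt_const
        exact hz ⟨i, (sub_eq_zero.1 h).symm⟩
      germ := germ
      radius := min r₁ (2 * T)⁻¹
      radius_pos := lt_min hr₁ (by positivity)
      eq_zero_of_mem := fun z hz => hball z (Metric.ball_subset_ball (min_le_left _ _) hz)
      germ_analyticAt := fun z hz => analyticAt_tsum_pow_smul (by positivity) he (hsmall z hz)
      germ_hasDerivAt := hderiv }
  -- The poles are simple and finite in number, and the remaining part is constant, so the bound
  -- holds up to infinity.
  have hbound : ∀ ν > 0, ∃ K, ∀ z, (∀ w ∈ Set.range a, ν < dist z w) → ‖S.coef z‖ ≤ K := by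
    intro ν hν
    refine ⟨‖(shift κ : PrimitiveSpace ι →L[ℂ] PrimitiveSpace ι)‖ + ∑ i, ν⁻¹ * ‖R i‖,
      fun z hz => ?_⟩
    refine (norm_add_le _ _).trans (add_le_add le_rfl (norm_sum_le_of_le _ fun i _ => ?_))
    rw [norm_smul, norm_inv, ← dist_eq_norm]
    gcongr
    exact (hz _ ⟨i, rfl⟩).le
  have hcoeff : ∀ k, PowerSeries.coeff k (borelTransform f) = borelCoeffFun y κ k (0, i₀) := by
    intro k
    simp [borelTransform, hf, borelCoeffFun]
  refine ⟨⟨(4 * T)⁻¹, by positivity, ?_⟩, _, S.isSummableResurgentFunction hbound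
    (lp.evalCLM ℂ (fun _ : ℕ × ι => ℂ) ⊤ (0, i₀)), ?_⟩
  · refine Summable.of_nonneg_of_le (fun _ => by positivity) (fun k => ?_)
      (summable_geometric_two.mul_left (C * T))
    rw [hcoeff]
    calc ‖borelCoeffFun y κ k (0, i₀)‖ * (4 * T)⁻¹ ^ k
        ≤ C * T * (2 * T) ^ k * (4 * T)⁻¹ ^ k := by gcongr; exact hbd k _
      _ = C * T * (1 / 2) ^ k := by
        rw [mul_assoc, ← mul_pow]
        congr 2
        field_simp
        norm_num
  · filter_upwards [S.continuation_origin_eventually] with q hq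
    rw [hq.1]
    have hg := (lp.evalCLM ℂ (fun _ : ℕ × ι => ℂ) ⊤ (0, i₀)).hasSum
      (hgerm _ (hsmall _ hq.2))
    refine HasSum.congr_fun hg fun k => ?_
    rw [hcoeff, mul_comm]
    rfl

end BorelPlane

/-! ### Application to level-one systems -/

theorem IsConvergent.exists_bound {f : ℂ⟦X⟧} (h : IsConvergent f) :
    ∃ M s : ℝ, 0 ≤ M ∧ 0 < s ∧ ∀ l, ‖PowerSeries.coeff l f‖ ≤ M * s ^ l := by
  obtain ⟨r, hr, hs⟩ := h
  refine ⟨∑' m, ‖PowerSeries.coeff m f‖ * r ^ m, r⁻¹, tsum_nonneg fun m => by positivity,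
    inv_pos.2 hr, fun l => ?_⟩
  rw [inv_pow, ← div_eq_mul_inv, le_div_iff₀ (by positivity)]
  exact hs.le_tsum l fun m _ => by positivity

theorem exists_common_bound {κ : Type*} [Finite κ] {f : κ → ℂ⟦X⟧} (h : ∀ x, IsConvergent (f x)) :
    ∃ M s : ℝ, 0 ≤ M ∧ 0 < s ∧ ∀ x l, ‖PowerSeries.coeff l (f x)‖ ≤ M * s ^ l := by
  have := Fintype.ofFinite κ
  choose M s hM hs hb using fun x => (h x).exists_bound
  refine ⟨∑ x, M x, 1 + ∑ x, s x, Finset.sum_nonneg fun x _ => hM x,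
    add_pos_of_pos_of_nonneg one_pos (Finset.sum_nonneg fun x _ => (hs x).le), fun x l => ?_⟩
  refine (hb x l).trans (mul_le_mul ?_ ?_ (by have := hs x; positivity)
    (Finset.sum_nonneg fun x _ => hM x))
  · exact Finset.single_le_sum (fun x _ => hM x) (Finset.mem_univ x)
  · refine pow_le_pow_left₀ (hs x).le ?_ l
    have := Finset.single_le_sum (f := s) (fun x _ => (hs x).le) (Finset.mem_univ x)
    linarith

section Prepared

variable {J : ℕ} [NeZero J] {n : Fin J → ℕ} {a lam : Fin J → ℂ}
  {A F : Matrix (Σ j, Fin (n j)) (Σ j, Fin (n j)) ℂ⟦X⟧}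

/-- The constant term of `A` is the diagonal matrix of the Stokes values. -/
theorem IsPrepared.coeff_zero (h : IsPrepared n a lam A F) (i j : Σ j, Fin (n j)) :
    PowerSeries.coeff 0 (A i j) = if i = j then a i.1 else 0 := by
  -- At `x = 0` both `x² F'` and the part of the normal form with factor `x` disappear, and `F(0) =
  -- 1`, so `A` and the normal form have the same value.
  have h1 := congrArg (fun B => B.map (PowerSeries.constantCoeff (R := ℂ))) h.formal_solution
  have hF := h.F_zero
  have hN : (normalForm n a lam).map (PowerSeries.constantCoeff (R := ℂ)) =
      Matrix.diagonal fun i : Σ j, Fin (n j) => a i.1 := by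
    ext i j
    rcases i with ⟨i, i'⟩
    rcases j with ⟨j, j'⟩
    rw [Matrix.map_apply, normalForm, Matrix.blockDiagonal'_apply, Matrix.diagonal_apply]
    by_cases hij : i = j
    · subst hij
      by_cases hij' : i' = j'
      · subst hij'
        simp
      · simp [hij']
    · simp [hij]
  have h2 : (A.map (PowerSeries.constantCoeff (R := ℂ))) =
      Matrix.diagonal fun i : Σ j, Fin (n j) => a i.1 := by
    have h3 : (A * F).map (PowerSeries.constantCoeff (R := ℂ)) =
        A.map (PowerSeries.constantCoeff (R := ℂ)) := by
      rw [Matrix.map_mul, hF, mul_one]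
    have h4 : (F * normalForm n a lam).map (PowerSeries.constantCoeff (R := ℂ)) =
        Matrix.diagonal fun i : Σ j, Fin (n j) => a i.1 := by
      rw [Matrix.map_mul, hF, one_mul, hN]
    rw [← h3, ← h4]
    rw [← h1]
    ext i j
    simp
  have := congrFun (congrFun h2 i) j
  rw [Matrix.map_apply, Matrix.diagonal_apply] at this
  rw [PowerSeries.coeff_zero_eq_constantCoeff_apply]
  exact this

/-- The equation satisfied by the first block of columns of the formal solution. -/
theorem IsPrepared.column_eq (h : IsPrepared n a lam A F) (i : Σ j, Fin (n j)) (k : Fin (n 0)) :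
    (PowerSeries.X : ℂ⟦X⟧) ^ 2 * PowerSeries.derivative ℂ (F i ⟨0, k⟩) +
      PowerSeries.X * ∑ k' : Fin (n 0), (if (k' : ℕ) + 1 = k then F i ⟨0, k'⟩ else 0) =
      ∑ j, A i j * F j ⟨0, k⟩ := by
  have h1 := congrFun (congrFun h.formal_solution i) ⟨0, k⟩
  rw [Matrix.add_apply, Matrix.mul_apply, Matrix.mul_apply, Matrix.smul_apply, Matrix.map_apply,
    smul_eq_mul] at h1
  rw [← h1]
  congr 1
  rw [Fintype.sum_sigma, Finset.sum_eq_single (0 : Fin J), Finset.mul_sum]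
  · refine Finset.sum_congr rfl fun k' _ => ?_
    rw [normalForm, Matrix.blockDiagonal'_apply_eq, h.a_zero, h.lam_zero]
    simp only [map_zero, zero_smul, zero_add, Matrix.smul_apply, jordan, Matrix.of_apply,
      smul_eq_mul]
    split_ifs <;> ring
  · intro j _ hj
    refine Finset.sum_eq_zero fun k' _ => ?_
    rw [normalForm, Matrix.blockDiagonal'_apply_ne _ _ _ hj, mul_zero]
  · simp

/-- The matrix of the system `x² Y' = B(x) Y` satisfied by the first block of columns. -/
def columnMatrix (A : Matrix (Σ j, Fin (n j)) (Σ j, Fin (n j)) ℂ⟦X⟧)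
    (x y : (Σ j, Fin (n j)) × Fin (n 0)) : ℂ⟦X⟧ :=
  (if x.2 = y.2 then A x.1 y.1 else 0) -
    (if x.1 = y.1 ∧ (y.2 : ℕ) + 1 = x.2 then PowerSeries.X else 0)

theorem isConvergent_columnMatrix (h : ∀ i k, IsConvergent (A i k))
    (x y : (Σ j, Fin (n j)) × Fin (n 0)) : IsConvergent (columnMatrix A x y) := by
  have h0 : IsConvergent 0 := ⟨1, one_pos, by simp⟩
  have hX : IsConvergent PowerSeries.X := ⟨1, one_pos, by
    refine summable_of_ne_finset_zero (s := {1}) fun m hm => ?_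
    rw [PowerSeries.coeff_X, if_neg (by simpa using hm)]
    simp⟩
  have hsub : ∀ f g : ℂ⟦X⟧, IsConvergent f → IsConvergent g → IsConvergent (f - g) := by
    rintro f g ⟨r, hr, hf⟩ ⟨r', hr', hg⟩
    refine ⟨min r r', lt_min hr hr', Summable.of_nonneg_of_le (fun m => ?_) (fun m => ?_)
      (hf.add hg)⟩
    · have := lt_min hr hr'; positivity
    · have h1 : min r r' ^ m ≤ r ^ m :=
        pow_le_pow_left₀ (lt_min hr hr').le (min_le_left _ _) m
      have h2 : min r r' ^ m ≤ r' ^ m :=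
        pow_le_pow_left₀ (lt_min hr hr').le (min_le_right _ _) m
      calc ‖PowerSeries.coeff m (f - g)‖ * min r r' ^ m
          ≤ (‖PowerSeries.coeff m f‖ + ‖PowerSeries.coeff m g‖) * min r r' ^ m := by
            rw [map_sub]
            have := (lt_min hr hr').le
            gcongr
            exact norm_sub_le _ _
        _ ≤ _ := by
            rw [add_mul]
            gcongr
  refine hsub _ _ ?_ ?_
  · split_ifs
    exacts [h _ _, h0]
  · split_ifs
    exacts [hX, h0]

/-- The nilpotent block couples each column to the previous one, so no single column need satisfy a
homogeneous system alone. Stacked together, the columns of the first block do, thanks to `a 0 = lam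
0 = 0`. -/
theorem IsPrepared.columnMatrix_eq (h : IsPrepared n a lam A F)
    (x : (Σ j, Fin (n j)) × Fin (n 0)) :
    (PowerSeries.X : ℂ⟦X⟧) ^ 2 * PowerSeries.derivative ℂ (F x.1 ⟨0, x.2⟩) =
      ∑ y : (Σ j, Fin (n j)) × Fin (n 0), columnMatrix A x y * F y.1 ⟨0, y.2⟩ := by
  rw [eq_sub_of_add_eq (h.column_eq x.1 x.2)]
  simp only [columnMatrix, sub_mul, Finset.sum_sub_distrib]
  congr 1
  · rw [Fintype.sum_prod_type]
    refine Finset.sum_congr rfl fun j _ => ?_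
    simp [ite_mul]
  · rw [Fintype.sum_prod_type, Finset.sum_eq_single x.1, Finset.mul_sum]
    · refine Finset.sum_congr rfl fun k' _ => ?_
      simp only [true_and]
      split_ifs <;> simp
    · intro j _ hj
      exact Finset.sum_eq_zero fun k' _ => by simp [hj.symm]
    · simp

/-- The coupling between columns carries a factor `x`, so the constant term stays diagonal, with the
Stokes values as entries. -/
theorem IsPrepared.coeff_columnMatrix (h : IsPrepared n a lam A F)
    (x y : (Σ j, Fin (n j)) × Fin (n 0)) :
    PowerSeries.coeff 0 (columnMatrix A x y) = if x = y then a x.1.1 else 0 := by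
  rw [columnMatrix, map_sub]
  have h2 : PowerSeries.coeff 0
      (if x.1 = y.1 ∧ (y.2 : ℕ) + 1 = x.2 then (PowerSeries.X : ℂ⟦X⟧) else 0) = 0 := by
    split_ifs <;> simp
  rw [h2, sub_zero]
  by_cases h3 : x.2 = y.2
  · rw [if_pos h3, h.coeff_zero]
    simp [Prod.ext_iff, h3]
  · rw [if_neg h3]
    simp [Prod.ext_iff, h3]

/-- This is the coefficient of `x^(m+1)` in the stacked system. The diagonal constant term of the
matrix isolates `a · y_{m+1}`; all other terms involve indices at most `m`. -/
theorem IsPrepared.recurrence (h : IsPrepared n a lam A F) (m : ℕ)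
    (x : (Σ j, Fin (n j)) × Fin (n 0)) :
    (m : ℂ) * PowerSeries.coeff m (F x.1 ⟨0, x.2⟩) =
      a x.1.1 * PowerSeries.coeff (m + 1) (F x.1 ⟨0, x.2⟩) +
        ∑ l ∈ Finset.range (m + 1), ∑ y : (Σ j, Fin (n j)) × Fin (n 0),
          PowerSeries.coeff (l + 1) (columnMatrix A x y) *
            PowerSeries.coeff (m - l) (F y.1 ⟨0, y.2⟩) := by
  have h1 := congrArg (PowerSeries.coeff (m + 1)) (h.columnMatrix_eq x)
  have h2 : PowerSeries.coeff (m + 1)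
      ((PowerSeries.X : ℂ⟦X⟧) ^ 2 * PowerSeries.derivative ℂ (F x.1 ⟨0, x.2⟩)) =
      (m : ℂ) * PowerSeries.coeff m (F x.1 ⟨0, x.2⟩) := by
    rw [PowerSeries.coeff_X_pow_mul']
    rcases m with _ | m
    · simp
    · rw [if_pos (by omega), show m + 1 + 1 - 2 = m by omega]
      rw [PowerSeries.coeff_derivative, mul_comm]
      push_cast
      rfl
  rw [h2, map_sum] at h1
  rw [h1]
  simp only [PowerSeries.coeff_mul, Finset.Nat.sum_antidiagonal_eq_sum_range_succ_mk]
  rw [Finset.sum_comm, Finset.sum_range_succ', add_comm]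
  congr 1
  · rw [Finset.sum_eq_single x]
    · rw [h.coeff_columnMatrix, if_pos rfl, Nat.sub_zero]
    · intro y _ hy
      rw [h.coeff_columnMatrix, if_neg hy.symm, zero_mul]
    · simp
  · refine Finset.sum_congr rfl fun l _ => ?_
    simp only [Nat.add_sub_add_right]

end Prepared

end LevelOne

end

theorem theorem1 {J : ℕ} [NeZero J] (n : Fin J → ℕ) (a lam : Fin J → ℂ)
    (A F : Matrix (Σ j, Fin (n j)) (Σ j, Fin (n j)) (PowerSeries ℂ))
    (h : LevelOne.IsPrepared n a lam A F) :
    ∀ (i : Σ j, Fin (n j)) (k : Fin (n 0)),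
      LevelOne.IsSummableResurgent (Set.range a) (F i ⟨0, k⟩) := by
  intro i k
  -- Stacking repeats the Stokes values but loses none, because every block is nonempty and `k`
  -- gives a column index.
  have hrange : Set.range a =
      Set.range fun x : (Σ j, Fin (n j)) × Fin (n 0) => a x.1.1 := by
    ext z
    constructor
    · rintro ⟨j, rfl⟩
      exact ⟨(⟨j, ⟨0, h.size_pos j⟩⟩, k), rfl⟩
    · rintro ⟨x, rfl⟩
      exact ⟨x.1.1, rfl⟩
  obtain ⟨M, s, hM, hs, hb⟩ := LevelOne.exists_common_bound
    (f := fun x : ((Σ j, Fin (n j)) × Fin (n 0)) × ((Σ j, Fin (n j)) × Fin (n 0)) =>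
      LevelOne.columnMatrix A x.1 x.2)
    fun x => LevelOne.isConvergent_columnMatrix h.convergent x.1 x.2
  rw [hrange]
  exact LevelOne.isSummableResurgent_of_recurrence
    (b := fun l x y => PowerSeries.coeff l (LevelOne.columnMatrix A x y))
    (y := fun m x => PowerSeries.coeff m (F x.1 ⟨0, x.2⟩))
    (hrange ▸ ⟨0, h.a_zero⟩) hs hM (fun l x y => hb (x, y) l) h.recurrence (i, k) _ fun m => rfl
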